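/- Noise model. A quantum circuit on a finite set of qubits is executed during $[0,T]$. Each of its finitely many locations (gates, including idle steps and the evolution that accompanies preparations and measurements) acts on a non-empty set of qubits during a time window of positive length, and no qubit takes part in two locations at the same time. The system is coupled to an arbitrary bath, and the joint Hamiltonian is $H=H_S+H_B+H_{SB}$, where $H_S(t)$ is the sum of the Hamiltonians of the gates being executed at time $t$, $H_B$ is an arbitrary self-adjoint bath Hamiltonian (with a unitary propagator), and $$H_{SB}=\sum_{k\ge1}\frac1{k!}\sum_{i_1,\dots,i_k}H^{(k)}_{i_1\dots i_k}.$$ Here $H^{(k)}_{i_1\dots i_k}$ is a bounded self-adjoint, possibly time-dependent operator that acts on the qubits $i_1,\dots,i_k$ and arbitrarily on the bath; it is symmetric in its indices, vanishes if two of them coincide, and has a norm that is bounded uniformly in time. Let $t_0$ be the maximal duration of a location. For a set $I$ of $r$ locations let $E(I)$ be the sum of all terms in the expansion of the joint evolution operator over $[0,T]$ in powers of $H_{SB}$, to all orders, for which every location in $I$ is faulty, i.e. at least one of its qubits is struck at least once by a term of $H_{SB}$ during the execution of that location. The noise has effective noise strength $\varepsilon\ge 0$ if, for every set $I$ of locations,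 with $r=|I|$, the sum $E(I)$ converges and $\|E(I)\|\le\varepsilon^r$. Statement. Fix $p>1$ and $m\in\mathbb N$, put $C(\alpha)=(1-2\alpha)^{-1}$, and for a noise model let $$\alpha_p=\max_{k\ge1}\Big[\frac{k^p}{k!}\Big(\max_{i_1}\sum_{i_2,\dots,i_k}\|H^{(k)}_{i_1\dots i_k}\|\,t_0\Big)\Big]^{1/k},$$ where the inner maximum is over all qubits $i_1$ and all times in $[0,T]$ (a supremum where no maximum is attained), and the sums are over all qubits. Then: 1. $\sum_{k\ge1}\frac1{2k^p}<\infty$, and every noise model in which each location acts on at most $m$ qubits and $\alpha_p<\tfrac12$ has effective noise strength $$\varepsilon=2m\,\alpha_p\,\exp\Big(C(\alpha_p)\sum_{k=1}^\infty\frac1{2k^p}\Big).$$ 2. Consequently the noise can be brought below any threshold: for every $\varepsilon_0>0$ there is $\alpha_0>0$, depending only on $p$, $m$ and $\varepsilon_0$, such that every noise model in which each location acts on at most $m$ qubits and $\alpha_p<\alpha_0$ has an effective noise strength $\varepsilon<\varepsilon_0$. 3. For $p=2$ the bound in 1, as a function of $\alpha=\alpha_2$, equals $2m\alpha\,(e^{\pi^2/12})^{C(\alpha)}$;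 divided by $\alpha$ it tends to $2e^{\pi^2/12}\,m$ as $\alpha\to0^+$, and $|2e^{\pi^2/12}-4.55|<0.005$. -/

import Mathlib

open MeasureTheory Filter Topology

noncomputable section

/-- The joint Hilbert space of the system qubits `Q` and a bath `B`, that is `(ℂ²)^{⊗Q} ⊗ B`:
families of bath vectors indexed by the computational basis strings `Q → Fin 2`, with the
Hilbert-space norm. -/
abbrev JointSpace (Q B : Type*) : Type _ := PiLp 2 (fun _ : Q → Fin 2 => B)

/-- The Hilbert space `(ℂ²)^{⊗Q}` of the system qubits. -/
abbrev SystemSpace (Q : Type*) : Type _ := JointSpace Q ℂ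

section Operators

variable {Q : Type*} [Fintype Q] [DecidableEq Q]
variable {B : Type*} [NormedAddCommGroup B] [InnerProductSpace ℂ B]

/-- The basis string that equals `u` on `S` and `x` off `S`. -/
def patch (S : Finset Q) (x : Q → Fin 2) (u : S → Fin 2) : Q → Fin 2 :=
  fun i => if h : i ∈ S then u ⟨i, h⟩ else x i

/-- `A` acts only on the qubits in `S`, and arbitrarily on the bath `B`: it is the identity on the
qubits off `S`, tensored with an operator on `(ℂ²)^{⊗S} ⊗ B`, whose blocks are `a u v`. -/
def ActsOn (S : Finset Q) (A : JointSpace Q B →L[ℂ] JointSpace Q B) : Prop :=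
  ∃ a : (S → Fin 2) → (S → Fin 2) → (B →L[ℂ] B), ∀ (ψ : JointSpace Q B) (x : Q → Fin 2),
    A ψ x = ∑ v : S → Fin 2, a (fun i => x i) v (ψ (patch S x v))

/-- The operator `A ⊗ V`, for `A` on the system and `V` on the bath. -/
def tensorOp (A : SystemSpace Q →L[ℂ] SystemSpace Q) (V : B →L[ℂ] B) :
    JointSpace Q B →L[ℂ] JointSpace Q B :=
  (PiLp.continuousLinearEquiv 2 ℂ (fun _ : Q → Fin 2 => B)).symm.toContinuousLinearMap ∘L
    ContinuousLinearMap.pi fun x : Q → Fin 2 =>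
      ∑ y : Q → Fin 2, (A (PiLp.single 2 y (1 : ℂ)) x) • (V ∘L PiLp.proj 2 (fun _ => B) y)

end Operators

/-- `U t s` is the unitary propagator (from time `s` to time `t`) of the Schrödinger equation
`i dψ/dt = H(t) ψ`, for a time-dependent, possibly unbounded, Hamiltonian `H`. The equation is
required in integrated form and for a dense set of initial states, so that bounded Hamiltonians
that jump in time and unbounded ones are both covered. -/
structure IsPropagator {E : Type*} [NormedAddCommGroup E] [InnerProductSpace ℂ E]
    [CompleteSpace E] (H : ℝ → E →ₗ.[ℂ] E) (U : ℝ → ℝ → E →L[ℂ] E) : Prop where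
  unitary : ∀ t s, U t s ∈ unitary (E →L[ℂ] E)
  self : ∀ t, U t t = 1
  comp : ∀ t s r, U t s ∘L U s r = U t r
  continuous : ∀ ψ, Continuous fun q : ℝ × ℝ => U q.1 q.2 ψ
  schrodinger : ∀ s, Dense {ψ : E | ∃ φ : ℝ → E,
    (∀ τ, (U τ s ψ, φ τ) ∈ (H τ).graph) ∧
    ∀ t, IntervalIntegrable φ volume s t ∧ U t s ψ = ψ - Complex.I • ∫ τ in s..t, φ τ}

/-- A quantum circuit on the qubits `Q`, with set of locations `Loc`, executed during `[0, T]`.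
The location `l` acts on the qubits `qubits l` during the time window `[start l, finish l)`, under
the Hamiltonian `gateHam l`. No qubit takes part in two locations at the same time. -/
structure Circuit (Q Loc : Type*) [Fintype Q] [DecidableEq Q] where
  T : ℝ
  T_nonneg : 0 ≤ T
  qubits : Loc → Finset Q
  qubits_nonempty : ∀ l, (qubits l).Nonempty
  start : Loc → ℝ
  finish : Loc → ℝ
  start_nonneg : ∀ l, 0 ≤ start l
  start_lt_finish : ∀ l, start l < finish l
  finish_le : ∀ l, finish l ≤ T
  disjoint : ∀ l l', l ≠ l' → ¬ Disjoint (qubits l) (qubits l') →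
    Disjoint (Set.Ico (start l) (finish l)) (Set.Ico (start l') (finish l'))
  gateHam : Loc → ℝ → (SystemSpace Q →L[ℂ] SystemSpace Q)
  gateHam_selfAdjoint : ∀ l t, IsSelfAdjoint (gateHam l t)
  gateHam_actsOn : ∀ l t, ActsOn (qubits l) (gateHam l t)

namespace Circuit

variable {Q Loc : Type*} [Fintype Q] [DecidableEq Q] (C : Circuit Q Loc)

/-- The time window during which the location `l` is executed. -/
def window (l : Loc) : Set ℝ := Set.Ico (C.start l) (C.finish l)

/-- The maximal duration `t₀` of any location. -/
def maxDuration : ℝ := ⨆ l, (C.finish l - C.start l)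

/-- The ideal system Hamiltonian `H_S(t)`: the sum of the Hamiltonians of the gates that are
being executed at time `t`. -/
def systemHam [Fintype Loc] (t : ℝ) : SystemSpace Q →L[ℂ] SystemSpace Q :=
  ∑ l, (C.window l).indicator (C.gateHam l) t

end Circuit

/-- A circuit coupled to a bath: the joint Hamiltonian is
`H = H_S + H_B + H_SB`, `H_SB = ∑_S term S`, where `term S` acts on the set `S` of qubits and
arbitrarily on the bath. The bath Hamiltonian is any self-adjoint, possibly unbounded and
time-dependent, operator that has a propagator. -/
structure NoiseModel (Q Loc B : Type*) [Fintype Q] [DecidableEq Q] [Fintype Loc]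
    [NormedAddCommGroup B] [InnerProductSpace ℂ B] [CompleteSpace B] extends Circuit Q Loc where
  /-- the evolution under `H_S` alone -/
  systemProp : ℝ → ℝ → (SystemSpace Q →L[ℂ] SystemSpace Q)
  systemProp_isPropagator :
    IsPropagator (fun t => (toCircuit.systemHam t).toLinearMap.toPMap ⊤) systemProp
  bathHam : ℝ → B →ₗ.[ℂ] B
  bathHam_selfAdjoint : ∀ t, IsSelfAdjoint (bathHam t)
  /-- the evolution under `H_B` alone -/
  bathProp : ℝ → ℝ → (B →L[ℂ] B)
  bathProp_isPropagator : IsPropagator bathHam bathProp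
  term : Finset Q → ℝ → (JointSpace Q B →L[ℂ] JointSpace Q B)
  term_empty : ∀ t, term ∅ t = 0
  term_selfAdjoint : ∀ S t, IsSelfAdjoint (term S t)
  term_actsOn : ∀ S t, ActsOn S (term S t)
  term_measurable : ∀ S ψ, StronglyMeasurable fun t => term S t ψ
  term_bounded : ∃ M : ℝ, ∀ S, ∀ t ∈ Set.Icc 0 T, ‖term S t‖ ≤ M

namespace NoiseModel

variable {Q Loc B : Type*} [Fintype Q] [DecidableEq Q] [Fintype Loc]
  [NormedAddCommGroup B] [InnerProductSpace ℂ B] [CompleteSpace B] (M : NoiseModel Q Loc B)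

/-- The term `H^{(k)}_{i_1, …, i_k}(t)` labelled by an ordered `k`-tuple of qubits: symmetric in
the indices, and zero if two of them coincide. -/
def tupleTerm {k : ℕ} (i : Fin k → Q) (t : ℝ) : JointSpace Q B →L[ℂ] JointSpace Q B :=
  open Classical in
  if Function.Injective i then M.term (Finset.univ.image i) t else 0

/-- `max_{i_1} ∑_{i_2, …, i_k} ‖H^{(k)}_{i_1, …, i_k}‖ t₀` for `k ≥ 1`, the maximum being over all
qubits and all times of the computation. -/
def eta (k : ℕ) : ℝ :=
  (⨆ q : Q × Set.Icc (0 : ℝ) M.T, ∑ r : Fin (k - 1) → Q,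
    ‖M.tupleTerm (Fin.cons q.1 r : Fin (k - 1 + 1) → Q) q.2‖) * M.maxDuration

/-- `α_p = max_{k ≥ 1} [ (k^p / k!) max_{i_1} ∑ ‖H^{(k)}‖ t₀ ]^{1/k}`. -/
def alpha (p : ℝ) : ℝ :=
  ⨆ k : ℕ+, (((k : ℕ) : ℝ) ^ p / ((k : ℕ).factorial : ℝ) * M.eta k) ^ (1 / ((k : ℕ) : ℝ))

/-- The joint evolution from time `s` to time `t` under `H_S + H_B`. -/
def freeProp (t s : ℝ) : JointSpace Q B →L[ℂ] JointSpace Q B :=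
  tensorOp (M.systemProp t s) (M.bathProp t s)

/-- The monomial in the expansion of the joint evolution from time `0` to time `s` in powers of
`H_SB` in which the terms labelled `a 0, a 1, …` act at the times `t 0, t 1, …`, in this order:
`U₀(s, t_{N-1}) (-i H_{a (N-1)}(t_{N-1})) ⋯ (-i H_{a 0}(t_0)) U₀(t_0, 0)`. -/
def monomial : (N : ℕ) → (Fin N → Finset Q) → (Fin N → ℝ) → ℝ →
    (JointSpace Q B →L[ℂ] JointSpace Q B)
  | 0, _, _, s => M.freeProp s 0
  | N + 1, a, t, s =>
      M.freeProp s (t (Fin.last N)) ∘L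
        ((-Complex.I) • M.term (a (Fin.last N)) (t (Fin.last N))) ∘L
          monomial N (Fin.init a) (Fin.init t) (t (Fin.last N))

/-- The location `l` is faulty in the history in which the terms `a j` act at the times `t j`: at
least one of its qubits is struck at least once by a term during the execution of `l`. -/
def Faulty (l : Loc) {N : ℕ} (a : Fin N → Finset Q) (t : Fin N → ℝ) : Prop :=
  ∃ j, t j ∈ M.window l ∧ (a j ∩ M.qubits l).Nonempty

/-- The time-ordered `N`-tuples of times in `[0, T]` for which every location in `I` is faulty. -/
def faultTimes (I : Finset Loc) {N : ℕ} (a : Fin N → Finset Q) : Set (Fin N → ℝ) :=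
  {t | Monotone t ∧ (∀ j, t j ∈ Set.Icc 0 M.T) ∧ ∀ l ∈ I, M.Faulty l a t}

/-- `E` is `E(I)`, the sum, to all orders, of all the terms in the expansion of the joint evolution
over `[0, T]` in powers of `H_SB` for which every location in `I` is faulty. The integrals over
time and the series are those of the vectors obtained by applying the operators to a state, and
they are required to converge. -/
def IsFaultOperator (I : Finset Loc) (E : JointSpace Q B →L[ℂ] JointSpace Q B) : Prop :=
  ∀ ψ : JointSpace Q B,
    (∀ (N : ℕ) (a : Fin N → Finset Q),
      IntegrableOn (fun t => M.monomial N a t M.T ψ) (M.faultTimes I a)) ∧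
    HasSum (fun N : ℕ => ∑ a : Fin N → Finset Q,
      ∫ t in M.faultTimes I a, M.monomial N a t M.T ψ) (E ψ)

/-- The noise has effective noise strength `ε`: `‖E(I)‖ ≤ ε ^ r` for every set `I` of `r`
circuit locations. -/
def HasEffectiveNoiseStrength (ε : ℝ) : Prop :=
  0 ≤ ε ∧ ∀ I : Finset Loc, ∃ E : JointSpace Q B →L[ℂ] JointSpace Q B,
    M.IsFaultOperator I E ∧ ‖E‖ ≤ ε ^ I.card

end NoiseModel

/-- `C(α) = (1 - 2α)⁻¹`. -/
def enhancement (α : ℝ) : ℝ := (1 - 2 * α)⁻¹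

/-- `2 m α exp (C(α) ∑_{k ≥ 1} 1 / (2 k^p))`. -/
def noiseBound (m : ℕ) (p α : ℝ) : ℝ :=
  2 * m * α * Real.exp (enhancement α * ∑' k : ℕ+, 1 / (2 * ((k : ℕ) : ℝ) ^ p))

end

/-! In the interaction picture the free evolution, being unitary, drops out of all norms, and `E(I)`
has the norm of the Dyson series restricted to the histories that hit every location in `I`. Write
`Φ_R(s)` for that series on `[0, s]` with target set `R`. Splitting off the last event gives `Φ_R(s)
= [R = ∅] ψ + ∫₀ˢ ∑_b -i h_b(τ) Φ_{R \ hit b}(τ) dτ` (`dysonSum_eq_integral`).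

Terms that miss `R` send `Φ_R` to itself under a self-adjoint generator, which leaves the norm
unchanged; hence their number and size never enter. Only terms that hit `R` can make the norm grow,
and they act on `Φ_{R'}` with `R'` strictly smaller. Strong induction on `R` (`norm_dysonSum_le`,
resting on `norm_le_add_of_integral_eq`) yields `‖Φ_R(s)‖ ≤ w^|R| exp(∫₀ˢ ∑_{l ∈ R} k_l) ‖ψ‖` as
soon as `∑_{b hits R} ‖h_b‖ w^|R \ hit b| ≤ w^|R| ∑_{l ∈ R} k_l` at each time.

This domination (`sum_norm_interactionTerm_mul_pow_le`) is used with `w = 2ma`, where `α_p < a <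
1/2`, and with `k_l = D / t₀` on the window of `l`, where `D = ∑ 1 / (2 k^p)`. A `k`-qubit term hits
some `n ≤ k` locations of `R` at once, and `2 m a^k k ≤ n (2ma)^n` (`two_mul_pow_mul_le`) allows its
cost to be shared among them, `‖h‖ / (2 m a^k k)` each. By the definition of `α_p` the shares of all
terms through one qubit add up to at most `D / (m t₀)` (`sum_norm_term_div_le`), and a location has
at most `m` qubits.

A window is no longer than `t₀`, so each location contributes at most `D` to the exponent. The
result is `(2 m a e^D)^|I|`, which implies the asserted bound because `C(a) ≥ 1`. Letting `a`
decrease to `α_p` finishes part 1; part 2 is continuity of the bound at `0`, and part 3 uses `ζ(2) =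
π²/6`. -/

noncomputable section

/-! ### Measurability of operator families in the strong sense -/

section StrongMeasurability

variable {X E F : Type*} [MeasurableSpace X] [NormedAddCommGroup E]
  [NormedAddCommGroup F]

/-- Applying a strongly measurable family of operators to a strongly measurable family of
vectors. -/
theorem stronglyMeasurable_apply [NormedSpace ℂ E] [NormedSpace ℂ F] {A : X → E →L[ℂ] F}
    (hA : ∀ v, StronglyMeasurable fun x => A x v) {f : X → E} (hf : StronglyMeasurable f) :
    StronglyMeasurable fun x => A x (f x) := by
  -- Approximating the vectors by simple functions reduces the claim to finitely many fixed vectors;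
  -- continuity of each `A x` then suffices for the limit.
  refine stronglyMeasurable_of_tendsto atTop (f := fun n x => A x (hf.approx n x)) (fun n => ?_) ?_
  · have : (fun x => A x (hf.approx n x)) = fun x => ∑ v ∈ (hf.approx n).range,
        ((hf.approx n) ⁻¹' {v}).indicator (fun x => A x v) x := by
      funext x
      rw [Finset.sum_eq_single (hf.approx n x)]
      · simp
      · intro b _ hb
        rw [Set.indicator_of_notMem]
        simpa using hb.symm
      · intro h
        exact absurd (SimpleFunc.mem_range_self _ x) h
    rw [this]
    exact Finset.stronglyMeasurable_fun_sum _ fun v _ =>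
      (hA v).indicator ((hf.approx n).measurableSet_fiber v)
  · rw [tendsto_pi_nhds]
    intro x
    exact ((A x).continuous.tendsto _).comp (hf.tendsto_approx x)

/-- Selecting from a finite family of strongly measurable functions by a measurable index. -/
theorem stronglyMeasurable_select {ι : Type*} [Fintype ι] {f : ι → X → E}
    (hf : ∀ i, StronglyMeasurable (f i)) {ρ : X → ι} (hρ : ∀ i, MeasurableSet {x | ρ x = i}) :
    StronglyMeasurable fun x => f (ρ x) x := by
  classical
  have : (fun x => f (ρ x) x) = fun x => ∑ i, {x | ρ x = i}.indicator (f i) x := by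
    funext x
    rw [Finset.sum_eq_single (ρ x)]
    · simp
    · intro b _ hb
      rw [Set.indicator_of_notMem]
      simpa using hb.symm
    · simp
  rw [this]
  exact Finset.stronglyMeasurable_fun_sum _ fun i _ => (hf i).indicator (hρ i)

end StrongMeasurability

/-! ### Dyson words restricted to histories that hit a given set -/

section Dyson

variable {A L H : Type*} [NormedAddCommGroup H] [InnerProductSpace ℂ H]

/-- The time-ordered product `(-i h_{a (N-1)}(t_{N-1})) ⋯ (-i h_{a 0}(t_0))`. -/
def dysonWord (h : A → ℝ → H →L[ℂ] H) : (N : ℕ) → (Fin N → A) → (Fin N → ℝ) → (H →L[ℂ] H)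
  | 0, _, _ => 1
  | N + 1, a, t => ((-Complex.I) • h (a (Fin.last N)) (t (Fin.last N))) ∘L
      dysonWord h N (Fin.init a) (Fin.init t)

/-- The ordered tuples of times in `[0, s]` for which every element of `R` is hit. -/
def dysonTimes (hit : A → ℝ → Finset L) (R : Finset L) {N : ℕ} (a : Fin N → A) (s : ℝ) :
    Set (Fin N → ℝ) :=
  {t | Monotone t ∧ (∀ j, t j ∈ Set.Icc 0 s) ∧ ∀ l ∈ R, ∃ j, l ∈ hit (a j) (t j)}

/-- The contribution of the sequence of letters `a` to the Dyson series on `[0, s]`, restricted to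
the times at which every element of `R` is hit. -/
def dysonPart (h : A → ℝ → H →L[ℂ] H) (hit : A → ℝ → Finset L) {N : ℕ} (a : Fin N → A)
    (R : Finset L) (s : ℝ) (ψ : H) : H :=
  ∫ t in dysonTimes hit R a s, dysonWord h N a t ψ

variable {h : A → ℝ → H →L[ℂ] H} {hit : A → ℝ → Finset L} {c : ℝ}

theorem stronglyMeasurable_dysonWord (hm : ∀ a ψ, StronglyMeasurable fun t => h a t ψ) (ψ : H) :
    ∀ (N : ℕ) (a : Fin N → A), StronglyMeasurable fun t => dysonWord h N a t ψ
  | 0, _ => stronglyMeasurable_const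
  | N + 1, a => by
    have h1 : StronglyMeasurable fun t : Fin (N + 1) → ℝ =>
        dysonWord h N (Fin.init a) (Fin.init t) ψ :=
      (stronglyMeasurable_dysonWord hm ψ N (Fin.init a)).comp_measurable
        (measurable_pi_lambda _ fun j => measurable_pi_apply _)
    have h2 : ∀ φ, StronglyMeasurable fun t : Fin (N + 1) → ℝ =>
        h (a (Fin.last N)) (t (Fin.last N)) φ := fun φ =>
      (hm _ φ).comp_measurable (measurable_pi_apply _)
    exact (stronglyMeasurable_apply h2 h1).const_smul (-Complex.I)

theorem norm_dysonWord_le (hc : ∀ a t, ‖h a t‖ ≤ c) (ψ : H) :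
    ∀ (N : ℕ) (a : Fin N → A) (t : Fin N → ℝ), ‖dysonWord h N a t ψ‖ ≤ c ^ N * ‖ψ‖
  | 0, _, _ => by simp [dysonWord]
  | N + 1, a, t => by
    have h0 : 0 ≤ c := (norm_nonneg _).trans (hc (a (Fin.last N)) 0)
    have ih := norm_dysonWord_le hc ψ N (Fin.init a) (Fin.init t)
    calc ‖dysonWord h (N + 1) a t ψ‖
        = ‖h (a (Fin.last N)) (t (Fin.last N)) (dysonWord h N (Fin.init a) (Fin.init t) ψ)‖ := by
          simp [dysonWord, norm_smul]
      _ ≤ c * (c ^ N * ‖ψ‖) := (ContinuousLinearMap.le_opNorm _ _).trans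
          (mul_le_mul (hc _ _) ih (norm_nonneg _) h0)
      _ = c ^ (N + 1) * ‖ψ‖ := by ring

/-- Measurability is needed jointly in the end time and the event times, so that integrating out the
latter leaves a measurable function of the former. -/
theorem measurableSet_dysonTimes_graph (hhit : ∀ a l, MeasurableSet {t | l ∈ hit a t})
    (R : Finset L) {N : ℕ} (a : Fin N → A) :
    MeasurableSet {q : ℝ × (Fin N → ℝ) | q.2 ∈ dysonTimes hit R a q.1} := by
  have h1 : MeasurableSet {q : ℝ × (Fin N → ℝ) | Monotone q.2} :=
    measurable_snd isClosed_monotone.measurableSet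
  have h2 : MeasurableSet {q : ℝ × (Fin N → ℝ) | ∀ j, q.2 j ∈ Set.Icc 0 q.1} := by
    rw [Set.ofPred_forall]
    refine MeasurableSet.iInter fun j => ?_
    have hj : Measurable fun q : ℝ × (Fin N → ℝ) => q.2 j :=
      (measurable_pi_apply j).comp measurable_snd
    exact (measurableSet_le measurable_const hj).inter (measurableSet_le hj measurable_fst)
  have h3 : MeasurableSet {q : ℝ × (Fin N → ℝ) | ∀ l ∈ R, ∃ j, l ∈ hit (a j) (q.2 j)} := by
    have : {q : ℝ × (Fin N → ℝ) | ∀ l ∈ R, ∃ j, l ∈ hit (a j) (q.2 j)} =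
        ⋂ l ∈ R, ⋃ j, (fun q : ℝ × (Fin N → ℝ) => q.2 j) ⁻¹' {t | l ∈ hit (a j) t} := by
      ext q; simp
    rw [this]
    exact Finset.measurableSet_biInter _ fun l _ => MeasurableSet.iUnion fun j =>
      ((measurable_pi_apply j).comp measurable_snd) (hhit (a j) l)
  exact h1.inter (h2.inter h3)

theorem measurableSet_dysonTimes (hhit : ∀ a l, MeasurableSet {t | l ∈ hit a t})
    (R : Finset L) {N : ℕ} (a : Fin N → A) (s : ℝ) : MeasurableSet (dysonTimes hit R a s) :=
  measurable_prodMk_left (measurableSet_dysonTimes_graph hhit R a)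

theorem integrableOn_dysonWord (hm : ∀ a ψ, StronglyMeasurable fun t => h a t ψ)
    (hc : ∀ a t, ‖h a t‖ ≤ c) (R : Finset L) {N : ℕ} (a : Fin N → A) (s : ℝ) (ψ : H) :
    IntegrableOn (fun t => dysonWord h N a t ψ) (dysonTimes hit R a s) := by
  refine Measure.integrableOn_of_bounded (M := c ^ N * ‖ψ‖) ?_
    (stronglyMeasurable_dysonWord hm ψ N a).aestronglyMeasurable
    (Eventually.of_forall fun t => norm_dysonWord_le hc ψ N a t)
  refine ne_top_of_le_ne_top ?_ (measure_mono (t := Set.Icc (fun _ => 0) (fun _ => s)) ?_)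
  · exact isCompact_Icc.measure_lt_top.ne
  · exact fun t ht => ⟨fun j => (ht.2.1 j).1, fun j => (ht.2.1 j).2⟩

theorem stronglyMeasurable_dysonPart (hm : ∀ a ψ, StronglyMeasurable fun t => h a t ψ)
    (hhit : ∀ a l, MeasurableSet {t | l ∈ hit a t}) (R : Finset L) {N : ℕ} (a : Fin N → A)
    (ψ : H) : StronglyMeasurable fun s => dysonPart h hit a R s ψ := by
  have h1 : StronglyMeasurable fun q : ℝ × (Fin N → ℝ) =>
      {q : ℝ × (Fin N → ℝ) | q.2 ∈ dysonTimes hit R a q.1}.indicator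
        (fun q => dysonWord h N a q.2 ψ) q :=
    ((stronglyMeasurable_dysonWord hm ψ N a).comp_measurable measurable_snd).indicator
      (measurableSet_dysonTimes_graph hhit R a)
  have h2 := h1.integral_prod_right' (ν := (volume : Measure (Fin N → ℝ)))
  convert h2 using 2 with s
  rw [dysonPart, ← integral_indicator (measurableSet_dysonTimes hhit R a s)]
  rfl

variable [DecidableEq L]

/-- Once the last event is fixed, the earlier ones range over `[0, t_last]` and only have to hit
what the last one left over. This is the source of the recursion. -/
theorem mem_dysonTimes_succ {R : Finset L} {N : ℕ} {a : Fin (N + 1) → A} {s : ℝ}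
    {t : Fin (N + 1) → ℝ} : t ∈ dysonTimes hit R a s ↔
      t (Fin.last N) ∈ Set.Icc 0 s ∧ Fin.init t ∈
        dysonTimes hit (R \ hit (a (Fin.last N)) (t (Fin.last N))) (Fin.init a)
          (t (Fin.last N)) := by
  constructor
  · rintro ⟨h1, h2, h3⟩
    refine ⟨h2 _, fun i j hij => h1 (Fin.castSucc_le_castSucc_iff.2 hij),
      fun j => ⟨(h2 _).1, h1 (Fin.le_last _)⟩, fun l hl => ?_⟩
    rw [Finset.mem_sdiff] at hl
    obtain ⟨j, hj⟩ := h3 l hl.1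
    induction j using Fin.lastCases with
    | last => exact absurd hj hl.2
    | cast j => exact ⟨j, hj⟩
  · rintro ⟨h0, h1, h2, h3⟩
    refine ⟨?_, fun j => ?_, fun l hl => ?_⟩
    · intro i j hij
      induction j using Fin.lastCases with
      | last =>
        induction i using Fin.lastCases with
        | last => exact le_rfl
        | cast i => exact (h2 i).2
      | cast j =>
        induction i using Fin.lastCases with
        | last => exact absurd hij (by simp)
        | cast i => exact h1 (Fin.castSucc_le_castSucc_iff.1 hij)
    · induction j using Fin.lastCases with
      | last => exact h0
      | cast j => exact ⟨(h2 j).1, (h2 j).2.trans h0.2⟩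
    · by_cases hl' : l ∈ hit (a (Fin.last N)) (t (Fin.last N))
      · exact ⟨_, hl'⟩
      · obtain ⟨j, hj⟩ := h3 l (Finset.mem_sdiff.2 ⟨hl, hl'⟩)
        exact ⟨j.castSucc, hj⟩

theorem dysonPart_zero (a : Fin 0 → A) (R : Finset L) (s : ℝ) (ψ : H) [CompleteSpace H] :
    dysonPart h hit a R s ψ = if R = ∅ then ψ else 0 := by
  rw [dysonPart, Measure.volume_pi_eq_dirac]
  split_ifs with hR
  · have : dysonTimes hit R a s = Set.univ := by
      ext t
      simp [dysonTimes, hR, Monotone]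
    rw [this, Measure.restrict_univ, integral_dirac]
    rfl
  · have : dysonTimes hit R a s = ∅ := by
      obtain ⟨l, hl⟩ := Finset.nonempty_iff_ne_empty.2 hR
      ext t
      simp only [dysonTimes, Set.mem_ofPred_eq, Set.mem_empty_iff_false, iff_false]
      rintro ⟨-, -, h3⟩
      obtain ⟨j, -⟩ := h3 l hl
      exact j.elim0
    simp [this]

/-- Fubini, with the latest time as the outer variable. -/
theorem dysonPart_succ [CompleteSpace H] (hm : ∀ a ψ, StronglyMeasurable fun t => h a t ψ)
    (hc : ∀ a t, ‖h a t‖ ≤ c) (hhit : ∀ a l, MeasurableSet {t | l ∈ hit a t})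
    {N : ℕ} (a : Fin (N + 1) → A) (R : Finset L) {s : ℝ} (hs : 0 ≤ s) (ψ : H) :
    dysonPart h hit a R s ψ = ∫ τ in (0 : ℝ)..s, (-Complex.I) • h (a (Fin.last N)) τ
      (dysonPart h hit (Fin.init a) (R \ hit (a (Fin.last N)) τ) τ ψ) := by
  set b := a (Fin.last N)
  set e := MeasurableEquiv.piFinSuccAbove (fun _ : Fin (N + 1) => ℝ) (Fin.last N) with he
  have mp : MeasurePreserving e volume volume :=
    volume_preserving_piFinSuccAbove (fun _ : Fin (N + 1) => ℝ) (Fin.last N)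
  let G : ℝ × (Fin N → ℝ) → H := fun q => (Set.Icc 0 s).indicator (fun τ =>
    (dysonTimes hit (R \ hit b τ) (Fin.init a) τ).indicator (fun t =>
      ((-Complex.I) • h b τ) (dysonWord h N (Fin.init a) t ψ)) q.2) q.1
  have hG : (fun t => (dysonTimes hit R a s).indicator (fun t => dysonWord h (N + 1) a t ψ) t)
      = fun t => G (e t) := by
    funext t
    have e1 : (e t).1 = t (Fin.last N) := rfl
    have e2 : (e t).2 = Fin.init t := by
      funext j
      simp [he, MeasurableEquiv.piFinSuccAbove_apply, Fin.init]
    simp only [G, e1, e2]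
    by_cases ht : t ∈ dysonTimes hit R a s
    · rw [Set.indicator_of_mem ht]
      rw [mem_dysonTimes_succ] at ht
      rw [Set.indicator_of_mem ht.1, Set.indicator_of_mem ht.2]
      rfl
    · rw [Set.indicator_of_notMem ht]
      rw [mem_dysonTimes_succ] at ht
      by_cases h1 : t (Fin.last N) ∈ Set.Icc 0 s
      · rw [Set.indicator_of_mem h1, Set.indicator_of_notMem (fun h2 => ht ⟨h1, h2⟩)]
      · rw [Set.indicator_of_notMem h1]
  have hint : Integrable G (volume.prod volume) := by
    have := (integrableOn_dysonWord hm hc R a s ψ (hit := hit)).integrable_indicator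
      (measurableSet_dysonTimes hhit R a s)
    rw [show (dysonTimes hit R a s).indicator (fun t => dysonWord h (N + 1) a t ψ) = G ∘ e from hG]
      at this
    exact (mp.integrable_comp_emb e.measurableEmbedding).1 this
  rw [dysonPart, ← integral_indicator (measurableSet_dysonTimes hhit R a s), hG,
    mp.integral_comp e.measurableEmbedding]
  change ∫ y, G y ∂(volume.prod volume) = _
  rw [integral_prod _ hint, intervalIntegral.integral_of_le hs, ← integral_Icc_eq_integral_Ioc,
    ← integral_indicator measurableSet_Icc]
  congr 1
  funext τ
  by_cases hτ : τ ∈ Set.Icc 0 s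
  · simp only [G, Set.indicator_of_mem hτ]
    rw [integral_indicator (measurableSet_dysonTimes hhit _ _ _),
      ContinuousLinearMap.integral_comp_comm _ (integrableOn_dysonWord hm hc _ _ _ _)]
    rfl
  · simp [G, Set.indicator_of_notMem hτ]

theorem measurableSet_sdiff_hit [Fintype L] (hhit : ∀ a l, MeasurableSet {t | l ∈ hit a t})
    (R : Finset L) (a : A) (R' : Finset L) : MeasurableSet {t | R \ hit a t = R'} := by
  have : {t | R \ hit a t = R'} =
      ⋂ l, {t | (l ∈ R ∧ l ∉ hit a t) ↔ l ∈ R'} := by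
    ext t
    simp [Finset.ext_iff]
  rw [this]
  refine MeasurableSet.iInter fun l => ?_
  have := hhit a l
  by_cases h1 : l ∈ R <;> by_cases h2 : l ∈ R' <;> simp only [h1, h2, true_and, false_and, iff_true,
    iff_false, not_not, Set.ofPred_true, Set.ofPred_false,
    MeasurableSet.univ, MeasurableSet.empty]
  exacts [this.compl, this]

theorem stronglyMeasurable_dysonPart_sdiff [Fintype L]
    (hm : ∀ a ψ, StronglyMeasurable fun t => h a t ψ)
    (hhit : ∀ a l, MeasurableSet {t | l ∈ hit a t}) {N : ℕ} (a : Fin N → A) (R : Finset L) (b : A)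
    (ψ : H) : StronglyMeasurable fun τ =>
      (-Complex.I) • h b τ (dysonPart h hit a (R \ hit b τ) τ ψ) :=
  (stronglyMeasurable_apply (hm b) (stronglyMeasurable_select
    (fun R' => stronglyMeasurable_dysonPart hm hhit R' a ψ)
    (measurableSet_sdiff_hit hhit R b))).const_smul (-Complex.I)

/-- The recursion retains the volume `s^N / N!` of the ordered simplex; this factorial makes the
series converge for bounded terms of any size. -/
theorem norm_dysonPart_le [CompleteSpace H] (hm : ∀ a ψ, StronglyMeasurable fun t => h a t ψ)
    (hc : ∀ a t, ‖h a t‖ ≤ c) (hhit : ∀ a l, MeasurableSet {t | l ∈ hit a t}) (ψ : H) :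
    ∀ {N : ℕ} (a : Fin N → A) (R : Finset L) {s : ℝ}, 0 ≤ s →
      ‖dysonPart h hit a R s ψ‖ ≤ (c * s) ^ N / N.factorial * ‖ψ‖
  | 0, a, R, s, hs => by
    rw [dysonPart_zero]
    split_ifs <;> simp
  | N + 1, a, R, s, hs => by
    have h0 : 0 ≤ c := (norm_nonneg _).trans (hc (a (Fin.last N)) 0)
    rw [dysonPart_succ hm hc hhit a R hs]
    have hI : ∫ τ in (0 : ℝ)..s, c * ((c * τ) ^ N / N.factorial * ‖ψ‖) =
        (c * s) ^ (N + 1) / (N + 1).factorial * ‖ψ‖ := by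
      have : ∀ τ : ℝ, c * ((c * τ) ^ N / N.factorial * ‖ψ‖) =
          (c ^ (N + 1) / N.factorial * ‖ψ‖) * τ ^ N := fun τ => by rw [mul_pow]; ring
      simp only [this, intervalIntegral.integral_const_mul, integral_pow]
      have : (N.factorial : ℝ) ≠ 0 := by positivity
      rw [Nat.factorial_succ, mul_pow]
      push_cast
      field_simp
      simp
    rw [← hI]
    refine intervalIntegral.norm_integral_le_of_norm_le hs (ae_of_all _ fun τ hτ => ?_)
      (Continuous.intervalIntegrable (by fun_prop) _ _)
    rw [norm_smul, norm_neg, Complex.norm_I, one_mul]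
    exact (ContinuousLinearMap.le_opNorm _ _).trans (mul_le_mul (hc _ _)
      (norm_dysonPart_le hm hc hhit ψ _ _ hτ.1.le) (norm_nonneg _) h0)

end Dyson

/-! ### Norm growth under a self-adjoint generator with a source -/

section Growth

/-- A function whose increments over `[s, t]` are at most quadratic in `t - s` does not increase. -/
theorem le_of_sub_le_sq {F : ℝ → ℝ} {T C : ℝ} (hT : 0 ≤ T)
    (hF : ∀ s t, 0 ≤ s → s ≤ t → t ≤ T → F t - F s ≤ C * (t - s) ^ 2) : F T ≤ F 0 := by
  -- Cutting `[0, T]` into `n + 1` equal steps leaves a total error of order `1 / (n + 1)`.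
  have key : ∀ n : ℕ, F T - F 0 ≤ C * T ^ 2 / ((n : ℝ) + 1) := by
    intro n
    have hn : (0 : ℝ) < (n : ℝ) + 1 := by positivity
    have hsum : ∑ i ∈ Finset.range (n + 1),
        (F (((i + 1 : ℕ) : ℝ) * (T / (n + 1))) - F ((i : ℝ) * (T / (n + 1)))) = F T - F 0 := by
      rw [Finset.sum_range_sub fun i : ℕ => F ((i : ℝ) * (T / (n + 1)))]
      have : ((n + 1 : ℕ) : ℝ) * (T / (n + 1)) = T := by push_cast; field_simp
      rw [this]; simp
    rw [← hsum]
    calc _ ≤ ∑ i ∈ Finset.range (n + 1), C * (T / (n + 1)) ^ 2 := by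
          refine Finset.sum_le_sum fun i hi => ?_
          have hi' : ((i + 1 : ℕ) : ℝ) ≤ (n : ℝ) + 1 := by
            exact_mod_cast Nat.succ_le_of_lt (Finset.mem_range.1 hi)
          have hd : 0 ≤ T / (n + 1) := by positivity
          refine (hF _ _ (by positivity) ?_ ?_).trans_eq ?_
          · push_cast; nlinarith
          · calc _ ≤ ((n : ℝ) + 1) * (T / (n + 1)) := by gcongr
              _ = T := by field_simp
          · push_cast; ring
      _ = C * T ^ 2 / ((n : ℝ) + 1) := by
          rw [Finset.sum_const, Finset.card_range, nsmul_eq_mul]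
          push_cast
          field_simp
  have hlim : Tendsto (fun n : ℕ => C * T ^ 2 / ((n : ℝ) + 1)) atTop (𝓝 0) :=
    tendsto_const_nhds.div_atTop (tendsto_atTop_add_const_right _ _ tendsto_natCast_atTop_atTop)
  linarith [ge_of_tendsto' hlim key]

variable {H : Type*} [NormedAddCommGroup H] [InnerProductSpace ℂ H]

theorem intervalIntegrable_of_norm_le {E : Type*} [NormedAddCommGroup E] {f : ℝ → E}
    (hf : StronglyMeasurable f) {s t C : ℝ} (hst : s ≤ t)
    (hC : ∀ τ ∈ Set.Icc s t, ‖f τ‖ ≤ C) : IntervalIntegrable f volume s t := by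
  rw [intervalIntegrable_iff_integrableOn_Ioc_of_le hst]
  refine Measure.integrableOn_of_bounded (M := C) (by simp) hf.aestronglyMeasurable ?_
  exact (ae_restrict_iff' measurableSet_Ioc).2
    (ae_of_all _ fun τ hτ => hC τ (Set.Ioc_subset_Icc_self hτ))

variable [CompleteSpace H]

/-- Under a self-adjoint generator with an inhomogeneity `g`, the norm grows at most by the
contribution of `g`. -/
theorem norm_le_add_of_integral_eq {φ g : ℝ → H} {K : ℝ → H →L[ℂ] H} {G : ℝ → ℝ} {T c B C : ℝ}
    (hT : 0 ≤ T) (hKm : ∀ v, StronglyMeasurable fun τ => K τ v)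
    (hKs : ∀ τ, IsSelfAdjoint (K τ)) (hKc : ∀ τ, ‖K τ‖ ≤ c)
    (hφm : StronglyMeasurable φ) (hgm : StronglyMeasurable g)
    (hφB : ∀ τ ∈ Set.Icc 0 T, ‖φ τ‖ ≤ B) (hgB : ∀ τ ∈ Set.Icc 0 T, ‖g τ‖ ≤ B)
    (hφ : ∀ s t, 0 ≤ s → s ≤ t → t ≤ T →
      φ t - φ s = ∫ τ in s..t, ((-Complex.I) • K τ (φ τ) + g τ))
    (hG : ∀ s t, 0 ≤ s → s ≤ t → t ≤ T → ‖∫ τ in s..t, g τ‖ ≤ G t - G s + C * (t - s) ^ 2) :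
    ‖φ T‖ ≤ ‖φ 0‖ + (G T - G 0) := by
  have hc0 : 0 ≤ c := (norm_nonneg _).trans (hKc 0)
  have hB0 : 0 ≤ B := (norm_nonneg _).trans (hφB 0 ⟨le_rfl, hT⟩)
  have hKφ : ∀ τ ∈ Set.Icc 0 T, ‖(-Complex.I) • K τ (φ τ)‖ ≤ c * B := fun τ hτ => by
    rw [norm_smul, norm_neg, Complex.norm_I, one_mul]
    exact (ContinuousLinearMap.le_opNorm _ _).trans
      (mul_le_mul (hKc _) (hφB _ hτ) (norm_nonneg _) hc0)
  have hKφm : StronglyMeasurable fun τ => (-Complex.I) • K τ (φ τ) :=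
    (stronglyMeasurable_apply hKm hφm).const_smul (-Complex.I)
  have hlip : ∀ s t, 0 ≤ s → s ≤ t → t ≤ T → ‖φ t - φ s‖ ≤ (c * B + B) * (t - s) := by
    intro s t hs hst ht
    rw [hφ s t hs hst ht, ← abs_of_nonneg (sub_nonneg.2 hst)]
    refine intervalIntegral.norm_integral_le_of_norm_le_const fun τ hτ => ?_
    rw [Set.uIoc_of_le hst] at hτ
    have hτ' : τ ∈ Set.Icc 0 T := ⟨hs.trans hτ.1.le, hτ.2.trans ht⟩
    exact (norm_add_le _ _).trans (add_le_add (hKφ τ hτ') (hgB τ hτ'))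
  suffices h : ‖φ T‖ - G T ≤ ‖φ 0‖ - G 0 by linarith
  -- The generator is merely measurable in time, so `φ` need not be differentiable and short steps
  -- replace a derivative. The three parts of the quadratic constant come from the step with `φ`
  -- frozen at `s`, from the error of freezing, and from `hG`.
  refine le_of_sub_le_sq (F := fun t => ‖φ t‖ - G t)
    (C := B * c ^ 2 + c * (c * B + B) + C) hT fun s t hs hst ht => ?_
  have hsub : ∀ {τ}, τ ∈ Set.Icc s t → τ ∈ Set.Icc 0 T := fun hτ =>
    ⟨hs.trans hτ.1, hτ.2.trans ht⟩
  have hsT : s ∈ Set.Icc 0 T := ⟨hs, hst.trans ht⟩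
  set δ := t - s
  have hδ : 0 ≤ δ := sub_nonneg.2 hst
  set w := ∫ τ in s..t, K τ (φ s)
  have i1 : IntervalIntegrable (fun τ => K τ (φ s)) volume s t :=
    intervalIntegrable_of_norm_le (hKm _) hst (C := c * ‖φ s‖) fun τ _ =>
      (ContinuousLinearMap.le_opNorm _ _).trans (by gcongr; exact hKc _)
  have i2 : IntervalIntegrable g volume s t :=
    intervalIntegrable_of_norm_le hgm hst fun τ hτ => hgB τ (hsub hτ)
  have i3 : IntervalIntegrable (fun τ => (-Complex.I) • K τ (φ τ)) volume s t :=
    intervalIntegrable_of_norm_le hKφm hst fun τ hτ => hKφ τ (hsub hτ)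
  have hw : ‖w‖ ≤ c * δ * ‖φ s‖ := by
    have := intervalIntegral.norm_integral_le_of_norm_le_const (a := s) (b := t)
      (f := fun τ => K τ (φ s)) (C := c * ‖φ s‖) fun τ _ =>
      (ContinuousLinearMap.le_opNorm _ _).trans (by gcongr; exact hKc _)
    rw [abs_of_nonneg hδ] at this
    linarith
  -- Self-adjointness makes `⟨φ s, w⟩` real, so `-i w` is orthogonal to `φ s` in the real sense and
  -- the frozen step changes the norm only at second order.
  have hre : (inner ℂ (φ s) ((-Complex.I) • w)).re = 0 := by
    have h1 : inner ℂ (φ s) w = ∫ τ in s..t, inner ℂ (φ s) (K τ (φ s)) := by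
      have := (innerSL ℂ (φ s)).intervalIntegral_comp_comm i1
      simpa using this.symm
    have h2 : ∀ τ, inner ℂ (φ s) (K τ (φ s)) =
        (((inner ℂ (φ s) (K τ (φ s)) : ℂ).re : ℝ) : ℂ) := fun τ => by
      have := ((hKs τ).isSymmetric).coe_re_inner_self_apply (φ s)
      exact this.symm
    have h3 : inner ℂ (φ s) w = ((∫ τ in s..t, (inner ℂ (φ s) (K τ (φ s)) : ℂ).re : ℝ) : ℂ) := by
      rw [h1, ← intervalIntegral.integral_ofReal]
      exact intervalIntegral.integral_congr fun τ _ => h2 τ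
    rw [inner_smul_right, h3]
    simp
  have hstep : ‖φ s + (-Complex.I) • w‖ ≤ ‖φ s‖ * (1 + c ^ 2 * δ ^ 2) := by
    refine le_of_sq_le_sq ?_ (by positivity)
    rw [@norm_add_sq ℂ, RCLike.re_eq_complex_re, hre, norm_smul, norm_neg, Complex.norm_I, one_mul]
    have h1 : ‖w‖ ^ 2 ≤ (c * δ * ‖φ s‖) ^ 2 := by gcongr
    have h2 : 0 ≤ ‖φ s‖ ^ 2 * (c ^ 2 * δ ^ 2) * (1 + c ^ 2 * δ ^ 2) := by positivity
    nlinarith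
  have hrem : ‖∫ τ in s..t, (-Complex.I) • K τ (φ τ - φ s)‖ ≤ c * ((c * B + B) * δ) * δ := by
    have := intervalIntegral.norm_integral_le_of_norm_le_const (a := s) (b := t)
      (f := fun τ => (-Complex.I) • K τ (φ τ - φ s)) (C := c * ((c * B + B) * δ)) fun τ hτ => by
        rw [Set.uIoc_of_le hst] at hτ
        rw [norm_smul, norm_neg, Complex.norm_I, one_mul]
        refine (ContinuousLinearMap.le_opNorm _ _).trans
          (mul_le_mul (hKc _) ((hlip s τ hs hτ.1.le (hτ.2.trans ht)).trans ?_) (norm_nonneg _) hc0)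
        have : τ - s ≤ δ := sub_le_sub_right hτ.2 s
        gcongr
    rwa [abs_of_nonneg hδ] at this
  have hdec : φ t = (φ s + (-Complex.I) • w) + (∫ τ in s..t, (-Complex.I) • K τ (φ τ - φ s))
      + ∫ τ in s..t, g τ := by
    have h1 : ∫ τ in s..t, (-Complex.I) • K τ (φ τ - φ s) =
        (∫ τ in s..t, (-Complex.I) • K τ (φ τ)) - (-Complex.I) • w := by
      simp only [map_sub, smul_sub]
      have i4 : IntervalIntegrable (fun τ => (-Complex.I) • K τ (φ s)) volume s t := i1.smul _
      rw [intervalIntegral.integral_sub i3 i4, intervalIntegral.integral_smul,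
        intervalIntegral.integral_smul]
    have h2 := hφ s t hs hst ht
    rw [intervalIntegral.integral_add i3 i2] at h2
    rw [h1, add_assoc, add_assoc, ← sub_eq_iff_eq_add', h2]
    abel
  have hfin : ‖φ t‖ ≤ ‖φ s‖ * (1 + c ^ 2 * δ ^ 2) + c * ((c * B + B) * δ) * δ
      + (G t - G s + C * δ ^ 2) := by
    rw [hdec]
    exact (norm_add_le _ _).trans (add_le_add ((norm_add_le _ _).trans (add_le_add hstep hrem))
      (hG s t hs hst ht))
  have hb : ‖φ s‖ * (c ^ 2 * δ ^ 2) ≤ B * (c ^ 2 * δ ^ 2) :=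
    mul_le_mul_of_nonneg_right (hφB s hsT) (by positivity)
  show ‖φ t‖ - G t - (‖φ s‖ - G s) ≤ _
  nlinarith

end Growth

/-! ### The restricted Dyson series and its integral equation -/

section DysonSum

variable {A L H : Type*} [Fintype A] [NormedAddCommGroup H] [InnerProductSpace ℂ H]

/-- The term of order `N` of the Dyson series on `[0, s]`, restricted to the times at which every
element of `R` is hit. -/
def dysonOrder (h : A → ℝ → H →L[ℂ] H) (hit : A → ℝ → Finset L) (N : ℕ) (R : Finset L) (s : ℝ)
    (ψ : H) : H :=
  ∑ a : Fin N → A, dysonPart h hit a R s ψ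

/-- The Dyson series on `[0, s]`, restricted to the times at which every element of `R` is hit. -/
def dysonSum (h : A → ℝ → H →L[ℂ] H) (hit : A → ℝ → Finset L) (R : Finset L) (s : ℝ) (ψ : H) : H :=
  ∑' N, dysonOrder h hit N R s ψ

variable {h : A → ℝ → H →L[ℂ] H} {hit : A → ℝ → Finset L} {c : ℝ}

theorem dysonOrder_zero [DecidableEq L] [CompleteSpace H] (R : Finset L) (s : ℝ) (ψ : H) :
    dysonOrder h hit 0 R s ψ = if R = ∅ then ψ else 0 := by
  simp [dysonOrder, dysonPart_zero]

theorem norm_dysonOrder_le [DecidableEq L] [CompleteSpace H]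
    (hm : ∀ a ψ, StronglyMeasurable fun t => h a t ψ)
    (hc : ∀ a t, ‖h a t‖ ≤ c) (hhit : ∀ a l, MeasurableSet {t | l ∈ hit a t})
    (N : ℕ) (R : Finset L) {s : ℝ} (hs : 0 ≤ s) (ψ : H) :
    ‖dysonOrder h hit N R s ψ‖ ≤ (Fintype.card A * (c * s)) ^ N / N.factorial * ‖ψ‖ := by
  refine (norm_sum_le_of_le _ fun a _ => norm_dysonPart_le hm hc hhit ψ a R hs).trans_eq ?_
  rw [Finset.sum_const, Finset.card_univ, Fintype.card_fun, Fintype.card_fin, nsmul_eq_mul,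
    mul_pow (Fintype.card A : ℝ)]
  push_cast
  ring

theorem stronglyMeasurable_dysonOrder (hm : ∀ a ψ, StronglyMeasurable fun t => h a t ψ)
    (hhit : ∀ a l, MeasurableSet {t | l ∈ hit a t}) (N : ℕ) (R : Finset L) (ψ : H) :
    StronglyMeasurable fun s => dysonOrder h hit N R s ψ :=
  Finset.stronglyMeasurable_fun_sum _ fun a _ => stronglyMeasurable_dysonPart hm hhit R a ψ

variable [DecidableEq L] [Fintype L] [CompleteSpace H]

omit [Fintype A] in
theorem intervalIntegrable_dysonPart_sdiff (hm : ∀ a ψ, StronglyMeasurable fun t => h a t ψ)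
    (hc : ∀ a t, ‖h a t‖ ≤ c) (hhit : ∀ a l, MeasurableSet {t | l ∈ hit a t})
    {N : ℕ} (a : Fin N → A) (R : Finset L) (b : A) {s : ℝ} (hs : 0 ≤ s) (ψ : H) :
    IntervalIntegrable (fun τ => (-Complex.I) • h b τ
      (dysonPart h hit a (R \ hit b τ) τ ψ)) volume 0 s := by
  have h0 : 0 ≤ c := (norm_nonneg _).trans (hc b 0)
  refine intervalIntegrable_of_norm_le (stronglyMeasurable_dysonPart_sdiff hm hhit a R b ψ) hs
    (C := c * ((c * s) ^ N / N.factorial * ‖ψ‖)) fun τ hτ => ?_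
  rw [norm_smul, norm_neg, Complex.norm_I, one_mul]
  have h1 := norm_dysonPart_le hm hc hhit ψ a (R \ hit b τ) hτ.1
  have h2 : (c * τ) ^ N / N.factorial * ‖ψ‖ ≤ (c * s) ^ N / N.factorial * ‖ψ‖ := by
    have := hτ.1
    have := hτ.2
    gcongr
  exact (ContinuousLinearMap.le_opNorm _ _).trans
    (mul_le_mul (hc _ _) (h1.trans h2) (norm_nonneg _) h0)

theorem dysonOrder_succ (hm : ∀ a ψ, StronglyMeasurable fun t => h a t ψ)
    (hc : ∀ a t, ‖h a t‖ ≤ c) (hhit : ∀ a l, MeasurableSet {t | l ∈ hit a t})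
    (N : ℕ) (R : Finset L) {s : ℝ} (hs : 0 ≤ s) (ψ : H) :
    dysonOrder h hit (N + 1) R s ψ = ∫ τ in (0 : ℝ)..s,
      ∑ b, (-Complex.I) • h b τ (dysonOrder h hit N (R \ hit b τ) τ ψ) := by
  simp only [dysonOrder, map_sum, Finset.smul_sum]
  rw [intervalIntegral.integral_finsetSum]
  · simp_rw [intervalIntegral.integral_finsetSum fun (a : Fin N → A) _ =>
      intervalIntegrable_dysonPart_sdiff hm hc hhit a R _ hs ψ]
    -- A word of length `N + 1` is its last letter together with the preceding word.
    rw [← (Fin.snocEquiv fun _ : Fin (N + 1) => A).sum_comp, Fintype.sum_prod_type]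
    refine Finset.sum_congr rfl fun b _ => Finset.sum_congr rfl fun a _ => ?_
    rw [dysonPart_succ hm hc hhit _ R hs]
    simp [Fin.snocEquiv]
  · intro b _
    simpa only [Finset.sum_fn] using IntervalIntegrable.sum Finset.univ fun a _ =>
      intervalIntegrable_dysonPart_sdiff (N := N) hm hc hhit a R b hs ψ

omit [Fintype L] in
theorem hasSum_dysonSum (hm : ∀ a ψ, StronglyMeasurable fun t => h a t ψ)
    (hc : ∀ a t, ‖h a t‖ ≤ c) (hhit : ∀ a l, MeasurableSet {t | l ∈ hit a t})
    (R : Finset L) {s : ℝ} (hs : 0 ≤ s) (ψ : H) :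
    HasSum (fun N => dysonOrder h hit N R s ψ) (dysonSum h hit R s ψ) :=
  (Summable.of_norm_bounded ((Real.summable_pow_div_factorial _).mul_right ‖ψ‖) fun N =>
    norm_dysonOrder_le hm hc hhit N R hs ψ).hasSum

omit [Fintype L] in
theorem norm_dysonSum_le_exp (hm : ∀ a ψ, StronglyMeasurable fun t => h a t ψ)
    (hc : ∀ a t, ‖h a t‖ ≤ c) (hhit : ∀ a l, MeasurableSet {t | l ∈ hit a t})
    (R : Finset L) {s : ℝ} (hs : 0 ≤ s) (ψ : H) :
    ‖dysonSum h hit R s ψ‖ ≤ Real.exp (Fintype.card A * (c * s)) * ‖ψ‖ := by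
  rw [Real.exp_eq_exp_ℝ]
  exact tsum_of_norm_bounded ((NormedSpace.expSeries_div_hasSum_exp
    (Fintype.card A * (c * s) : ℝ)).mul_right ‖ψ‖) fun N => norm_dysonOrder_le hm hc hhit N R hs ψ

omit [Fintype L] in
/-- The restricted Dyson series, set to zero at negative times, is strongly measurable in time. -/
theorem stronglyMeasurable_dysonSum (hm : ∀ a ψ, StronglyMeasurable fun t => h a t ψ)
    (hc : ∀ a t, ‖h a t‖ ≤ c) (hhit : ∀ a l, MeasurableSet {t | l ∈ hit a t})
    (R : Finset L) (ψ : H) :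
    StronglyMeasurable ((Set.Ici (0 : ℝ)).indicator fun s => dysonSum h hit R s ψ) := by
  refine stronglyMeasurable_of_tendsto atTop (f := fun n => (Set.Ici (0 : ℝ)).indicator fun s =>
    ∑ N ∈ Finset.range n, dysonOrder h hit N R s ψ) (fun n => ?_) ?_
  · exact (Finset.stronglyMeasurable_fun_sum _ fun N _ =>
      stronglyMeasurable_dysonOrder hm hhit N R ψ).indicator measurableSet_Ici
  · rw [tendsto_pi_nhds]
    intro s
    by_cases hs : 0 ≤ s
    · simpa [Set.indicator_of_mem (Set.mem_Ici.2 hs)] using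
        (hasSum_dysonSum hm hc hhit R hs ψ).tendsto_sum_nat
    · simp [Set.indicator_of_notMem (show s ∉ Set.Ici (0 : ℝ) from hs)]

/-- The order-by-order recursion is summed under the integral sign by dominated convergence, with an
exponential series as majorant. -/
theorem dysonSum_eq_integral (hm : ∀ a ψ, StronglyMeasurable fun t => h a t ψ)
    (hc : ∀ a t, ‖h a t‖ ≤ c) (hhit : ∀ a l, MeasurableSet {t | l ∈ hit a t})
    (R : Finset L) {s : ℝ} (hs : 0 ≤ s) (ψ : H) :
    dysonSum h hit R s ψ = (if R = ∅ then ψ else 0) + ∫ τ in (0 : ℝ)..s,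
      ∑ b, (-Complex.I) • h b τ (dysonSum h hit (R \ hit b τ) τ ψ) := by
  have hsum := hasSum_dysonSum hm hc hhit R hs ψ
  rw [← dysonOrder_zero (h := h) (hit := hit) R s ψ]
  have h1 : HasSum (fun N => dysonOrder h hit (N + 1) R s ψ)
      (∫ τ in (0 : ℝ)..s, ∑ b, (-Complex.I) • h b τ (dysonSum h hit (R \ hit b τ) τ ψ)) := by
    simp only [dysonOrder_succ hm hc hhit _ R hs ψ]
    refine intervalIntegral.hasSum_integral_of_dominated_convergence
      (fun N _ => Fintype.card A * (c * ((Fintype.card A * (c * s)) ^ N / N.factorial * ‖ψ‖)))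
      (fun N => ?_) (fun N => ae_of_all _ fun τ hτ => ?_) (ae_of_all _ fun τ hτ => ?_) ?_
      (ae_of_all _ fun τ hτ => ?_)
    · refine (Finset.stronglyMeasurable_fun_sum _ fun b _ => ?_).aestronglyMeasurable
      exact (stronglyMeasurable_apply (hm b) (stronglyMeasurable_select
        (fun R' => stronglyMeasurable_dysonOrder hm hhit N R' ψ)
        (measurableSet_sdiff_hit hhit R b))).const_smul (-Complex.I)
    · rw [Set.uIoc_of_le hs] at hτ
      rw [← nsmul_eq_mul, ← Finset.card_univ, ← Finset.sum_const]
      refine norm_sum_le_of_le _ fun b _ => ?_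
      have h0 : 0 ≤ c := (norm_nonneg _).trans (hc b 0)
      rw [norm_smul, norm_neg, Complex.norm_I, one_mul]
      refine (ContinuousLinearMap.le_opNorm _ _).trans
        (mul_le_mul (hc _ _) ((norm_dysonOrder_le hm hc hhit N _ hτ.1.le ψ).trans ?_)
          (norm_nonneg _) h0)
      have := hτ.1.le
      have := hτ.2
      gcongr
      exact Finset.card_univ.ge
    · exact (((Real.summable_pow_div_factorial _).mul_right _).mul_left _).mul_left _
    · exact intervalIntegrable_const
    · rw [Set.uIoc_of_le hs] at hτ
      refine hasSum_sum fun b _ => ?_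
      exact ((h b τ).hasSum (hasSum_dysonSum hm hc hhit (R \ hit b τ) hτ.1.le ψ)).const_smul _
  have h2 := (hasSum_nat_add_iff' (f := fun N => dysonOrder h hit N R s ψ) 1).2 hsum
  rw [Finset.sum_range_one] at h2
  exact eq_add_of_sub_eq' (h2.unique h1)

end DysonSum

/-! ### The weighted bound on the restricted series -/

section DysonBound

variable {A L H : Type*} [Fintype A] [NormedAddCommGroup H] [InnerProductSpace ℂ H]
  [CompleteSpace H] {h : A → ℝ → H →L[ℂ] H} {hit : A → ℝ → Finset L} {c : ℝ}

/-- The increment of the exponential dominates its tangent at the right end, up to second order. -/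
theorem exp_mul_sub_le {x y : ℝ} (hxy : x ≤ y) :
    Real.exp y * (y - x) ≤ Real.exp y - Real.exp x + Real.exp y * (y - x) ^ 2 := by
  have h1 : Real.exp x * (y - x) ≤ Real.exp y - Real.exp x := by
    have := mul_le_mul_of_nonneg_left (Real.add_one_le_exp (y - x)) (Real.exp_pos x).le
    rw [← Real.exp_add, add_sub_cancel] at this
    linarith
  have h2 : Real.exp y - Real.exp x ≤ Real.exp y * (y - x) := by
    have := mul_le_mul_of_nonneg_left (Real.add_one_le_exp (x - y)) (Real.exp_pos y).le
    rw [← Real.exp_add, add_sub_cancel] at this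
    linarith
  have h3 := mul_le_mul_of_nonneg_right h2 (sub_nonneg.2 hxy)
  linarith

variable [DecidableEq L] [Fintype L]

/-- If the letters that hit `R` satisfy a weighted bound with rates `k l`, then the Dyson series
restricted to the times at which every element of `R` is hit is bounded by
`w ^ |R| exp (∑_{l ∈ R} ∫ k l)`. -/
theorem norm_dysonSum_le (hm : ∀ a ψ, StronglyMeasurable fun t => h a t ψ)
    (hc : ∀ a t, ‖h a t‖ ≤ c) (hsa : ∀ a t, IsSelfAdjoint (h a t))
    (hhit : ∀ a l, MeasurableSet {t | l ∈ hit a t}) {k : L → ℝ → ℝ} {κ w : ℝ} (hw : 0 < w)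
    (hk0 : ∀ l t, 0 ≤ k l t) (hkκ : ∀ l t, k l t ≤ κ) (hkm : ∀ l, Measurable (k l))
    (hdom : ∀ (R : Finset L) (τ : ℝ),
      (∑ b with (hit b τ ∩ R).Nonempty, ‖h b τ‖ * w ^ (R \ hit b τ).card) ≤
        w ^ R.card * ∑ l ∈ R, k l τ) (ψ : H) (R : Finset L) :
    ∀ s, 0 ≤ s → ‖dysonSum h hit R s ψ‖ ≤
      w ^ R.card * Real.exp (∫ τ in (0 : ℝ)..s, ∑ l ∈ R, k l τ) * ‖ψ‖ := by
  induction R using Finset.strongInduction with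
  | H R ih =>
  intro T hT
  have hkR0 : ∀ (R : Finset L) τ, 0 ≤ ∑ l ∈ R, k l τ := fun R τ =>
    Finset.sum_nonneg fun l _ => hk0 l τ
  have hkRint : ∀ (R : Finset L) s t, IntervalIntegrable (fun τ => ∑ l ∈ R, k l τ) volume s t := by
    intro R s t
    have hsm : StronglyMeasurable fun τ => ∑ l ∈ R, k l τ :=
      (Finset.measurable_fun_sum R fun l _ => hkm l).stronglyMeasurable
    have hb : ∀ τ, ‖∑ l ∈ R, k l τ‖ ≤ ∑ l ∈ R, κ := fun τ =>
      norm_sum_le_of_le _ fun l _ => by rw [Real.norm_of_nonneg (hk0 l τ)]; exact hkκ l τ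
    rcases le_total s t with hst | hst
    · exact intervalIntegrable_of_norm_le hsm hst fun τ _ => hb τ
    · exact (intervalIntegrable_of_norm_le hsm hst fun τ _ => hb τ).symm
  set P : Finset L → ℝ → ℝ := fun R s => ∫ τ in (0 : ℝ)..s, ∑ l ∈ R, k l τ with hP
  have hPsub : ∀ R s t, P R t - P R s = ∫ τ in s..t, ∑ l ∈ R, k l τ := fun R s t =>
    intervalIntegral.integral_interval_sub_left (hkRint R 0 t) (hkRint R 0 s)
  have hPmono : ∀ R s t, s ≤ t → P R s ≤ P R t := fun R s t hst => by
    rw [← sub_nonneg, hPsub]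
    exact intervalIntegral.integral_nonneg hst fun τ _ => hkR0 R τ
  have hPsubset : ∀ R' ⊆ R, ∀ s, 0 ≤ s → P R' s ≤ P R s := fun R' hR' s hs =>
    intervalIntegral.integral_mono_on hs (hkRint R' 0 s) (hkRint R 0 s) fun τ _ =>
      Finset.sum_le_sum_of_subset_of_nonneg hR' fun l _ _ => hk0 l τ
  have hPlip : ∀ s t, s ≤ t → P R t - P R s ≤ (∑ l ∈ R, κ) * (t - s) := fun s t hst => by
    rw [hPsub]
    calc _ ≤ ∫ τ in s..t, ∑ l ∈ R, κ := intervalIntegral.integral_mono_on hst (hkRint R s t)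
          intervalIntegrable_const fun τ _ => Finset.sum_le_sum fun l _ => hkκ l τ
      _ = _ := by rw [intervalIntegral.integral_const, smul_eq_mul, mul_comm]
  by_cases hA : Nonempty A
  swap
  · rw [not_nonempty_iff] at hA
    rw [dysonSum_eq_integral hm hc hhit R hT]
    simp only [Finset.univ_eq_empty, Finset.sum_empty, intervalIntegral.integral_zero, add_zero]
    split_ifs with hR
    · simp [hR]
    · rw [norm_zero]; positivity
  have hc0 : 0 ≤ c := (norm_nonneg _).trans (hc hA.some 0)
  -- the part of the generator that hits nothing in `R`, and the rest
  let S : A → Set ℝ := fun b => {τ | (hit b τ ∩ R).Nonempty}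
  have hSm : ∀ b, MeasurableSet (S b) := fun b => by
    have : S b = ⋃ l ∈ R, {τ | l ∈ hit b τ} := by
      ext τ
      simp [S, Finset.Nonempty, and_comm]
    rw [this]
    exact Finset.measurableSet_biUnion _ fun l _ => hhit b l
  let φ : ℝ → H := (Set.Ici (0 : ℝ)).indicator fun s => dysonSum h hit R s ψ
  let K : ℝ → H →L[ℂ] H := fun τ => ∑ b, (S b)ᶜ.indicator (h b) τ
  let Φ : Finset L → ℝ → H := fun R' => (Set.Ici (0 : ℝ)).indicator fun s => dysonSum h hit R' s ψ
  let g : ℝ → H := fun τ => ∑ b,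
    (S b).indicator (fun τ => (-Complex.I) • h b τ (Φ (R \ hit b τ) τ)) τ
  have hΦm : ∀ R', StronglyMeasurable (Φ R') := fun R' =>
    stronglyMeasurable_dysonSum hm hc hhit R' ψ
  have hΦ : ∀ R' s, 0 ≤ s → Φ R' s = dysonSum h hit R' s ψ := fun R' s hs =>
    Set.indicator_of_mem (Set.mem_Ici.2 hs) _
  have hφ : ∀ s, 0 ≤ s → φ s = dysonSum h hit R s ψ := hΦ R
  have hφ0 : φ 0 = if R = ∅ then ψ else 0 := by
    rw [hφ 0 le_rfl, dysonSum_eq_integral hm hc hhit R le_rfl]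
    simp
  -- A letter that misses `R` leaves `R` as the target set, so it acts on `φ` itself and belongs to
  -- `K`; every other letter belongs to the source `g`.
  have hsplit : ∀ τ, 0 ≤ τ → ∑ b, (-Complex.I) • h b τ (dysonSum h hit (R \ hit b τ) τ ψ) =
      (-Complex.I) • K τ (φ τ) + g τ := by
    intro τ hτ
    simp only [K, g, sum_apply, Finset.smul_sum, ← Finset.sum_add_distrib]
    refine Finset.sum_congr rfl fun b _ => ?_
    by_cases hb : τ ∈ S b
    · rw [Set.indicator_of_mem hb, Set.indicator_of_notMem (by simpa using hb), hΦ _ _ hτ]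
      simp
    · rw [Set.indicator_of_notMem hb, Set.indicator_of_mem (by simpa using hb), hφ _ hτ]
      have : R \ hit b τ = R := by
        rw [Finset.sdiff_eq_self_iff_disjoint, Finset.disjoint_iff_inter_eq_empty,
          Finset.inter_comm]
        exact Finset.not_nonempty_iff_eq_empty.1 hb
      rw [this, add_zero]
  have hΦsm : ∀ b, StronglyMeasurable fun τ => (-Complex.I) • h b τ (Φ (R \ hit b τ) τ) :=
    fun b => (stronglyMeasurable_apply (hm b) (stronglyMeasurable_select hΦm
      (measurableSet_sdiff_hit hhit R b))).const_smul (-Complex.I)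
  have hgm : StronglyMeasurable g :=
    Finset.stronglyMeasurable_fun_sum _ fun b _ => (hΦsm b).indicator (hSm b)
  have hKm : ∀ v, StronglyMeasurable fun τ => K τ v := by
    intro v
    simp only [K, sum_apply]
    refine Finset.stronglyMeasurable_fun_sum _ fun b _ => ?_
    convert (hm b v).indicator (hSm b).compl using 2 with τ
    by_cases hb : τ ∈ (S b)ᶜ
    · rw [Set.indicator_of_mem hb, Set.indicator_of_mem hb]
    · rw [Set.indicator_of_notMem hb, Set.indicator_of_notMem hb]; rfl
  have hKs : ∀ τ, IsSelfAdjoint (K τ) := by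
    intro τ
    refine isSelfAdjoint_sum _ fun b _ => ?_
    by_cases hb : τ ∈ (S b)ᶜ
    · rw [Set.indicator_of_mem hb]; exact hsa b τ
    · rw [Set.indicator_of_notMem hb]; exact IsSelfAdjoint.zero _
  have hKc : ∀ τ, ‖K τ‖ ≤ ∑ _b : A, c := fun τ => norm_sum_le_of_le _ fun b _ =>
    (norm_indicator_le_norm_self _ _).trans (hc b τ)
  -- a crude bound
  set B₁ := Real.exp (Fintype.card A * (c * T)) * ‖ψ‖
  have hΦB : ∀ R', ∀ τ ∈ Set.Icc 0 T, ‖Φ R' τ‖ ≤ B₁ := by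
    intro R' τ hτ
    rw [hΦ _ _ hτ.1]
    refine (norm_dysonSum_le_exp hm hc hhit R' hτ.1 ψ).trans ?_
    have := hτ.2
    change _ ≤ Real.exp (Fintype.card A * (c * T)) * ‖ψ‖
    gcongr
  have hB₁ : 0 ≤ B₁ := by positivity
  have hgB₁ : ∀ τ ∈ Set.Icc 0 T, ‖g τ‖ ≤ ∑ _b : A, c * B₁ := by
    refine fun τ hτ => norm_sum_le_of_le _ fun b _ => (norm_indicator_le_norm_self _ _).trans ?_
    rw [norm_smul, norm_neg, Complex.norm_I, one_mul]
    exact (ContinuousLinearMap.le_opNorm _ _).trans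
      (mul_le_mul (hc _ _) (hΦB _ τ hτ) (norm_nonneg _) hc0)
  set β := w ^ R.card * ‖ψ‖ with hβ
  have hβ0 : 0 ≤ β := by positivity
  -- Each term of `g` carries a strictly smaller target set, to which the induction hypothesis
  -- applies. Its exponent is enlarged to that of `R`, and `hdom` sums the powers of `w`.
  have hgβ : ∀ τ ∈ Set.Icc 0 T, ‖g τ‖ ≤ β * Real.exp (P R τ) * ∑ l ∈ R, k l τ := by
    intro τ hτ
    calc ‖g τ‖ ≤ ∑ b, (S b).indicator (fun τ => ‖h b τ‖ * w ^ (R \ hit b τ).card) τ *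
          (Real.exp (P R τ) * ‖ψ‖) := by
          refine norm_sum_le_of_le _ fun b _ => ?_
          by_cases hb : τ ∈ S b
          · rw [Set.indicator_of_mem hb, Set.indicator_of_mem hb, norm_smul, norm_neg,
              Complex.norm_I, one_mul, mul_assoc]
            refine (ContinuousLinearMap.le_opNorm _ _).trans
              (mul_le_mul_of_nonneg_left ?_ (norm_nonneg _))
            rw [hΦ _ _ hτ.1, ← mul_assoc]
            have hss : R \ hit b τ ⊂ R := by
              obtain ⟨l, hl⟩ := hb
              rw [Finset.mem_inter] at hl
              exact Finset.ssubset_iff_subset_ne.2 ⟨Finset.sdiff_subset, fun heq => by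
                have := heq.symm ▸ hl.2
                exact (Finset.mem_sdiff.1 this).2 hl.1⟩
            refine (ih _ hss τ hτ.1).trans ?_
            have := hPsubset _ hss.1 τ hτ.1
            change w ^ _ * Real.exp (P (R \ hit b τ) τ) * ‖ψ‖ ≤ _
            gcongr
          · rw [Set.indicator_of_notMem hb, Set.indicator_of_notMem hb]; simp
      _ = (∑ b with (hit b τ ∩ R).Nonempty, ‖h b τ‖ * w ^ (R \ hit b τ).card) *
          (Real.exp (P R τ) * ‖ψ‖) := by
          rw [← Finset.sum_mul, Finset.sum_filter]
          congr 1
          refine Finset.sum_congr rfl fun b _ => ?_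
          by_cases hb : (hit b τ ∩ R).Nonempty
          · rw [if_pos hb, Set.indicator_of_mem (show τ ∈ S b from hb)]
          · rw [if_neg hb, Set.indicator_of_notMem (show τ ∉ S b from hb)]
      _ ≤ (w ^ R.card * ∑ l ∈ R, k l τ) * (Real.exp (P R τ) * ‖ψ‖) := by
          gcongr
          exact hdom R τ
      _ = _ := by rw [hβ]; ring
  have hmain := norm_le_add_of_integral_eq (φ := φ) (g := g) (K := K)
    (G := fun s => β * Real.exp (P R s)) (T := T) (c := ∑ _b : A, c)
    (B := max B₁ (∑ _b : A, c * B₁)) (C := β * Real.exp (P R T) * (∑ l ∈ R, κ) ^ 2)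
    hT hKm hKs hKc (hΦm R) hgm
    (fun τ hτ => (hΦB R τ hτ).trans (le_max_left _ _))
    (fun τ hτ => (hgB₁ τ hτ).trans (le_max_right _ _)) ?_ ?_
  · have h0 : ‖φ 0‖ ≤ β * Real.exp (P R 0) := by
      rw [hφ0]
      split_ifs with hR
      · simp [hR, hβ, hP]
      · rw [norm_zero]; positivity
    rw [← hφ T hT]
    calc ‖φ T‖ ≤ β * Real.exp (P R T) := by linarith
      _ = _ := by rw [hβ]; ring
  · intro s t hs hst ht
    have hII : ∀ s, 0 ≤ s → s ≤ T → IntervalIntegrable (fun τ => ∑ b, (-Complex.I) •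
        h b τ (Φ (R \ hit b τ) τ)) volume 0 s := by
      intro s hs hsT
      refine intervalIntegrable_of_norm_le (Finset.stronglyMeasurable_fun_sum _ fun b _ => hΦsm b)
        hs (C := ∑ _b : A, c * B₁) fun τ hτ => norm_sum_le_of_le _ fun b _ => ?_
      rw [norm_smul, norm_neg, Complex.norm_I, one_mul]
      exact (ContinuousLinearMap.le_opNorm _ _).trans
        (mul_le_mul (hc _ _) (hΦB _ τ ⟨hτ.1, hτ.2.trans hsT⟩) (norm_nonneg _) hc0)
    have hI : ∀ s, 0 ≤ s → φ s = (if R = ∅ then ψ else 0) +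
        ∫ τ in (0 : ℝ)..s, ∑ b, (-Complex.I) • h b τ (Φ (R \ hit b τ) τ) := by
      intro s hs
      rw [hφ s hs, dysonSum_eq_integral hm hc hhit R hs]
      congr 1
      refine intervalIntegral.integral_congr fun τ hτ => ?_
      rw [Set.uIcc_of_le hs] at hτ
      simp only [hΦ _ _ hτ.1]
    rw [hI s hs, hI t (hs.trans hst), add_sub_add_left_eq_sub,
      intervalIntegral.integral_interval_sub_left (hII t (hs.trans hst) ht)
        (hII s hs (hst.trans ht))]
    refine intervalIntegral.integral_congr fun τ hτ => ?_
    rw [Set.uIcc_of_le hst] at hτ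
    simp only [hΦ _ _ (hs.trans hτ.1)]
    exact hsplit τ (hs.trans hτ.1)
  · intro s t hs hst ht
    -- The exponential is frozen at the right end of the step. As `P R` is Lipschitz, the difference
    -- from the increment of `exp (P R)` is quadratic in `t - s`, as `hG` permits.
    have h1 : ‖∫ τ in s..t, g τ‖ ≤ ∫ τ in s..t, β * Real.exp (P R t) * ∑ l ∈ R, k l τ := by
      refine intervalIntegral.norm_integral_le_of_norm_le hst (ae_of_all _ fun τ hτ => ?_)
        ((hkRint R s t).const_mul _)
      refine (hgβ τ ⟨hs.trans hτ.1.le, hτ.2.trans ht⟩).trans ?_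
      have := hPmono R τ t hτ.2
      have := hkR0 R τ
      gcongr
    rw [intervalIntegral.integral_const_mul, ← hPsub] at h1
    have h2 := hPmono R s t hst
    have h3 := hPlip s t hst
    have h4 : Real.exp (P R t) ≤ Real.exp (P R T) := Real.exp_le_exp.2 (hPmono R t T ht)
    have h5 : (P R t - P R s) ^ 2 ≤ ((∑ l ∈ R, κ) * (t - s)) ^ 2 := by
      have := sub_nonneg.2 h2
      gcongr
    have h6 := exp_mul_sub_le h2
    have h7 : Real.exp (P R t) * (P R t - P R s) ^ 2 ≤
        Real.exp (P R T) * ((∑ l ∈ R, κ) * (t - s)) ^ 2 := by gcongr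
    calc _ ≤ β * (Real.exp (P R t) * (P R t - P R s)) := by linarith
      _ ≤ β * (Real.exp (P R t) - Real.exp (P R s) +
          Real.exp (P R T) * ((∑ l ∈ R, κ) * (t - s)) ^ 2) := by
          gcongr
          linarith
      _ = _ := by ring

end DysonBound

/-! ### The restricted series as a bounded operator -/

section DysonOperator

variable {A L H : Type*} [Fintype A] [NormedAddCommGroup H] [InnerProductSpace ℂ H]
  [CompleteSpace H] {h : A → ℝ → H →L[ℂ] H} {hit : A → ℝ → Finset L} {c : ℝ} [DecidableEq L]

/-- The restricted Dyson series is a bounded operator. -/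
theorem exists_dysonSum_eq (hm : ∀ a ψ, StronglyMeasurable fun t => h a t ψ)
    (hc : ∀ a t, ‖h a t‖ ≤ c) (hhit : ∀ a l, MeasurableSet {t | l ∈ hit a t}) (R : Finset L) {T : ℝ}
    (hT : 0 ≤ T) : ∃ E : H →L[ℂ] H, ∀ ψ, E ψ = dysonSum h hit R T ψ := by
  have hadd : ∀ N ψ φ, dysonOrder h hit N R T (ψ + φ) =
      dysonOrder h hit N R T ψ + dysonOrder h hit N R T φ := by
    intro N ψ φ
    rw [dysonOrder, dysonOrder, dysonOrder, ← Finset.sum_add_distrib]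
    refine Finset.sum_congr rfl fun a _ => ?_
    simp only [dysonPart, map_add]
    exact integral_add (integrableOn_dysonWord hm hc R a T ψ) (integrableOn_dysonWord hm hc R a T φ)
  have hsmul : ∀ N (z : ℂ) ψ, dysonOrder h hit N R T (z • ψ) = z • dysonOrder h hit N R T ψ := by
    intro N z ψ
    simp only [dysonOrder, dysonPart, map_smul, integral_smul, Finset.smul_sum]
  have hs := fun ψ => hasSum_dysonSum hm hc hhit R hT ψ
  let E₀ : H →ₗ[ℂ] H :=
    { toFun := fun ψ => dysonSum h hit R T ψ
      map_add' := fun ψ φ => by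
        refine (hs (ψ + φ)).unique ?_
        simp only [hadd]
        exact (hs ψ).add (hs φ)
      map_smul' := fun z ψ => by
        refine (hs (z • ψ)).unique ?_
        simp only [hsmul]
        exact (hs ψ).const_smul z }
  exact ⟨E₀.mkContinuous _ fun ψ => norm_dysonSum_le_exp hm hc hhit R hT ψ, fun ψ => rfl⟩

end DysonOperator

/-! ### Tensor products of system and bath operators -/

section Tensor

variable {Q B : Type*} [Fintype Q] [DecidableEq Q] [NormedAddCommGroup B] [InnerProductSpace ℂ B]

theorem tensorOp_apply (A : SystemSpace Q →L[ℂ] SystemSpace Q) (V : B →L[ℂ] B)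
    (ψ : JointSpace Q B) (x : Q → Fin 2) :
    tensorOp A V ψ x = ∑ y : Q → Fin 2, (A (PiLp.single 2 y (1 : ℂ)) x) • V (ψ y) := by
  simp [tensorOp]

theorem systemOp_apply (A : SystemSpace Q →L[ℂ] SystemSpace Q) (ψ : SystemSpace Q)
    (x : Q → Fin 2) : A ψ x = ∑ y : Q → Fin 2, ψ y * A (PiLp.single 2 y (1 : ℂ)) x := by
  have h : ψ = ∑ y, ψ y • PiLp.single 2 y (1 : ℂ) := by
    ext z
    simp [Pi.single_apply]
  conv_lhs => rw [h]
  simp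

theorem tensorOp_mul (A A' : SystemSpace Q →L[ℂ] SystemSpace Q) (V V' : B →L[ℂ] B) :
    tensorOp A V ∘L tensorOp A' V' = tensorOp (A ∘L A') (V ∘L V') := by
  ext ψ x
  simp only [ContinuousLinearMap.comp_apply, tensorOp_apply, map_sum, map_smul]
  simp only [systemOp_apply A (A' _), Finset.smul_sum, Finset.sum_smul]
  rw [Finset.sum_comm]
  refine Finset.sum_congr rfl fun y _ => Finset.sum_congr rfl fun z _ => ?_
  rw [smul_smul, mul_comm]

theorem tensorOp_one : tensorOp (1 : SystemSpace Q →L[ℂ] SystemSpace Q) (1 : B →L[ℂ] B) = 1 := by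
  ext ψ x
  simp [tensorOp_apply, PiLp.single_apply]

theorem continuous_tensorOp {X : Type*} [TopologicalSpace X]
    {A : X → SystemSpace Q →L[ℂ] SystemSpace Q} {V : X → B →L[ℂ] B}
    (hA : ∀ ψ, Continuous fun x => A x ψ) (hV : ∀ ψ, Continuous fun x => V x ψ)
    (ψ : JointSpace Q B) : Continuous fun x => tensorOp (A x) (V x) ψ := by
  refine (PiLp.homeomorph 2 (fun _ : Q → Fin 2 => B)).isInducing.continuous_iff.2 ?_
  refine continuous_pi fun x => ?_
  change Continuous fun q => tensorOp (A q) (V q) ψ x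
  simp only [tensorOp_apply]
  exact continuous_finsetSum _ fun y _ =>
    ((PiLp.continuous_apply 2 _ x).comp (hA _)).smul (hV _)

variable [CompleteSpace B]

theorem adjoint_tensorOp (A : SystemSpace Q →L[ℂ] SystemSpace Q) (V : B →L[ℂ] B) :
    ContinuousLinearMap.adjoint (tensorOp A V) =
      tensorOp (ContinuousLinearMap.adjoint A) (ContinuousLinearMap.adjoint V) := by
  symm
  rw [ContinuousLinearMap.eq_adjoint_iff]
  intro ψ φ
  have hA : ∀ x y : Q → Fin 2, ContinuousLinearMap.adjoint A (PiLp.single 2 y (1 : ℂ)) x =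
      (starRingEnd ℂ) (A (PiLp.single 2 x (1 : ℂ)) y) := by
    intro x y
    have := ContinuousLinearMap.adjoint_inner_left A (PiLp.single 2 x (1 : ℂ))
      (PiLp.single 2 y (1 : ℂ))
    simp [PiLp.inner_apply, PiLp.single_apply] at this
    rw [← this, Complex.conj_conj]
  simp only [PiLp.inner_apply, tensorOp_apply, sum_inner, inner_sum, inner_smul_left,
    inner_smul_right, ContinuousLinearMap.adjoint_inner_left, hA, Complex.conj_conj]
  exact Finset.sum_comm

end Tensor

namespace IsPropagator

variable {E : Type*} [NormedAddCommGroup E] [InnerProductSpace ℂ E] [CompleteSpace E]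
  {H : ℝ → E →ₗ.[ℂ] E} {U : ℝ → ℝ → E →L[ℂ] E}

theorem adjoint_eq (hU : IsPropagator H U) (t s : ℝ) :
    ContinuousLinearMap.adjoint (U t s) = U s t := by
  have h1 : ContinuousLinearMap.adjoint (U t s) ∘L U t s = 1 :=
    (Unitary.mem_iff.1 (hU.unitary t s)).1
  calc _ = ContinuousLinearMap.adjoint (U t s) ∘L (U t s ∘L U s t) := by
        rw [hU.comp, hU.self]; rfl
    _ = _ := by rw [← ContinuousLinearMap.comp_assoc, h1]; rfl

end IsPropagator

/-! ### The interaction picture of a noise model -/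

namespace NoiseModel

variable {Q Loc B : Type*} [Fintype Q] [DecidableEq Q] [Fintype Loc]
  [NormedAddCommGroup B] [InnerProductSpace ℂ B] [CompleteSpace B] (M : NoiseModel Q Loc B)

theorem freeProp_comp (t s r : ℝ) : M.freeProp t s ∘L M.freeProp s r = M.freeProp t r := by
  rw [freeProp, freeProp, tensorOp_mul, M.systemProp_isPropagator.comp,
    M.bathProp_isPropagator.comp]
  rfl

theorem freeProp_self (t : ℝ) : M.freeProp t t = 1 := by
  rw [freeProp, M.systemProp_isPropagator.self, M.bathProp_isPropagator.self, tensorOp_one]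

theorem adjoint_freeProp (t s : ℝ) :
    ContinuousLinearMap.adjoint (M.freeProp t s) = M.freeProp s t := by
  rw [freeProp, adjoint_tensorOp, M.systemProp_isPropagator.adjoint_eq,
    M.bathProp_isPropagator.adjoint_eq]
  rfl

theorem norm_freeProp_apply (t s : ℝ) (ψ : JointSpace Q B) : ‖M.freeProp t s ψ‖ = ‖ψ‖ := by
  refine (ContinuousLinearMap.norm_map_iff_adjoint_comp_self _).2 ?_ ψ
  rw [adjoint_freeProp, freeProp_comp, freeProp_self]

theorem continuous_freeProp (ψ : JointSpace Q B) :
    Continuous fun q : ℝ × ℝ => M.freeProp q.1 q.2 ψ :=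
  continuous_tensorOp (fun φ => M.systemProp_isPropagator.continuous φ)
    (fun φ => M.bathProp_isPropagator.continuous φ) ψ

/-- The term labelled `S` in the interaction picture, cut off outside `[0, T]`. -/
def interactionTerm (S : Finset Q) : ℝ → JointSpace Q B →L[ℂ] JointSpace Q B :=
  (Set.Icc 0 M.T).indicator fun t => M.freeProp 0 t ∘L M.term S t ∘L M.freeProp t 0

theorem interactionTerm_of_mem (S : Finset Q) {t : ℝ} (ht : t ∈ Set.Icc 0 M.T) :
    M.interactionTerm S t = M.freeProp 0 t ∘L M.term S t ∘L M.freeProp t 0 :=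
  Set.indicator_of_mem ht _

theorem interactionTerm_of_notMem (S : Finset Q) {t : ℝ} (ht : t ∉ Set.Icc 0 M.T) :
    M.interactionTerm S t = 0 :=
  Set.indicator_of_notMem ht _

theorem stronglyMeasurable_interactionTerm (S : Finset Q) (ψ : JointSpace Q B) :
    StronglyMeasurable fun t => M.interactionTerm S t ψ := by
  have h1 : StronglyMeasurable fun t => M.freeProp t 0 ψ :=
    ((M.continuous_freeProp ψ).comp (by fun_prop : Continuous fun t : ℝ => (t, (0 : ℝ)))
      ).stronglyMeasurable
  have h2 := stronglyMeasurable_apply (M.term_measurable S) h1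
  have h3 : StronglyMeasurable fun t => M.freeProp 0 t (M.term S t (M.freeProp t 0 ψ)) :=
    stronglyMeasurable_apply (fun φ => ((M.continuous_freeProp φ).comp
      (by fun_prop : Continuous fun t : ℝ => ((0 : ℝ), t))).stronglyMeasurable) h2
  convert h3.indicator (measurableSet_Icc (a := (0 : ℝ)) (b := M.T)) using 2 with t
  by_cases ht : t ∈ Set.Icc 0 M.T
  · rw [M.interactionTerm_of_mem S ht, Set.indicator_of_mem ht]; rfl
  · rw [M.interactionTerm_of_notMem S ht, Set.indicator_of_notMem ht]; rfl

theorem norm_interactionTerm_le (S : Finset Q) (t : ℝ) : ‖M.interactionTerm S t‖ ≤ ‖M.term S t‖ := by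
  by_cases ht : t ∈ Set.Icc 0 M.T
  · rw [M.interactionTerm_of_mem S ht]
    refine ContinuousLinearMap.opNorm_le_bound _ (norm_nonneg _) fun ψ => ?_
    rw [ContinuousLinearMap.comp_apply, norm_freeProp_apply, ContinuousLinearMap.comp_apply]
    exact (ContinuousLinearMap.le_opNorm _ _).trans_eq (by rw [norm_freeProp_apply])
  · rw [M.interactionTerm_of_notMem S ht, norm_zero]; exact norm_nonneg _

theorem isSelfAdjoint_interactionTerm (S : Finset Q) (t : ℝ) :
    IsSelfAdjoint (M.interactionTerm S t) := by
  by_cases ht : t ∈ Set.Icc 0 M.T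
  · rw [M.interactionTerm_of_mem S ht]
    have := M.term_selfAdjoint S t
    rw [ContinuousLinearMap.isSelfAdjoint_iff'] at this ⊢
    rw [ContinuousLinearMap.adjoint_comp, ContinuousLinearMap.adjoint_comp, this,
      adjoint_freeProp, adjoint_freeProp, ContinuousLinearMap.comp_assoc]
  · rw [M.interactionTerm_of_notMem S ht]; exact IsSelfAdjoint.zero (JointSpace Q B →L[ℂ] JointSpace Q B)

/-- Each free propagator is routed through time `0`, so that every term is conjugated into the
interaction picture and a single `freeProp s 0` remains in front. The times must lie in `[0, T]`,
since `interactionTerm` is cut off there. -/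
theorem monomial_eq {N : ℕ} (a : Fin N → Finset Q) {t : Fin N → ℝ}
    (ht : ∀ j, t j ∈ Set.Icc 0 M.T) (s : ℝ) :
    M.monomial N a t s = M.freeProp s 0 ∘L dysonWord M.interactionTerm N a t := by
  induction N generalizing s with
  | zero => rfl
  | succ N ih =>
    rw [monomial, ih (Fin.init a) (t := Fin.init t) (fun j => ht j.castSucc), dysonWord,
      M.interactionTerm_of_mem _ (ht _), ← M.freeProp_comp s (t (Fin.last N)) 0]
    ext1 ψ
    have h1 : ∀ φ, M.freeProp (t (Fin.last N)) 0 (M.freeProp 0 (t (Fin.last N)) φ) = φ := fun φ => by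
      rw [← ContinuousLinearMap.comp_apply, freeProp_comp, freeProp_self]; rfl
    simp only [ContinuousLinearMap.comp_apply, smul_apply, map_smul, h1]

/-- The locations struck by a term on `S` at time `t`. -/
def struck (S : Finset Q) (t : ℝ) : Finset Loc :=
  open Classical in
  Finset.univ.filter fun l => t ∈ M.window l ∧ (S ∩ M.qubits l).Nonempty

theorem mem_struck {S : Finset Q} {t : ℝ} {l : Loc} :
    l ∈ M.struck S t ↔ t ∈ M.window l ∧ (S ∩ M.qubits l).Nonempty := by
  simp [struck]

theorem measurableSet_struck (S : Finset Q) (l : Loc) : MeasurableSet {t | l ∈ M.struck S t} := by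
  by_cases h : (S ∩ M.qubits l).Nonempty
  · simp only [mem_struck, h, and_true]
    exact measurableSet_Ico
  · simp [mem_struck, h]

theorem faultTimes_eq (I : Finset Loc) {N : ℕ} (a : Fin N → Finset Q) :
    M.faultTimes I a = dysonTimes M.struck I a M.T := by
  ext t
  simp [faultTimes, dysonTimes, Faulty, mem_struck]

/-- The operator `E(I)` exists, and it has the norm of the restricted Dyson series. -/
theorem exists_isFaultOperator {c : ℝ} (hc : ∀ S t, ‖M.interactionTerm S t‖ ≤ c) (I : Finset Loc) :
    ∃ E, M.IsFaultOperator I E ∧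
      ∀ ψ, ‖E ψ‖ = ‖dysonSum M.interactionTerm M.struck I M.T ψ‖ := by
  classical
  have hm := M.stronglyMeasurable_interactionTerm
  have hhit := M.measurableSet_struck
  obtain ⟨E, hE⟩ := exists_dysonSum_eq hm hc hhit I M.T_nonneg
  have hmon : ∀ ψ (N : ℕ) (a : Fin N → Finset Q), ∀ t ∈ dysonTimes M.struck I a M.T,
      M.monomial N a t M.T ψ = M.freeProp M.T 0 (dysonWord M.interactionTerm N a t ψ) :=
    fun ψ N a t ht => by rw [M.monomial_eq a ht.2.1]; rfl
  refine ⟨M.freeProp M.T 0 ∘L E, fun ψ => ⟨fun N a => ?_, ?_⟩, fun ψ => ?_⟩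
  · rw [faultTimes_eq]
    exact ((M.freeProp M.T 0).integrable_comp (integrableOn_dysonWord hm hc I a M.T ψ)).congr
      ((ae_restrict_iff' (measurableSet_dysonTimes hhit I a M.T)).2
        (ae_of_all _ fun t ht => (hmon ψ N a t ht).symm))
  · have h := (M.freeProp M.T 0).hasSum (hasSum_dysonSum hm hc hhit I M.T_nonneg ψ)
    rw [← hE] at h
    refine h.congr_fun fun N => ?_
    rw [dysonOrder, map_sum]
    refine Finset.sum_congr rfl fun a _ => ?_
    rw [faultTimes_eq, setIntegral_congr_fun (measurableSet_dysonTimes hhit I a M.T) (hmon ψ N a),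
      ContinuousLinearMap.integral_comp_comm _ (integrableOn_dysonWord hm hc I a M.T ψ)]
    rfl
  · rw [ContinuousLinearMap.comp_apply, norm_freeProp_apply, hE]

end NoiseModel

/-! ### Combinatorial estimates: powers and enumerations -/

theorem summable_one_div_two_mul_rpow {p : ℝ} (hp : 1 < p) :
    Summable fun k : ℕ+ => 1 / (2 * ((k : ℕ) : ℝ) ^ p) := by
  have h : Summable fun k : ℕ+ => 1 / 2 * (1 / ((k : ℕ) : ℝ) ^ p) :=
    ((Real.summable_one_div_nat_rpow.2 hp).comp_injective PNat.coe_injective).mul_left _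
  refine h.congr fun k => ?_
  rw [one_div_mul_one_div]

theorem sum_le_tsum_one_div_two_mul_rpow {p : ℝ} (hp : 1 < p) (n : ℕ) :
    ∑ k ∈ Finset.range n, 1 / (2 * ((k + 1 : ℕ) : ℝ) ^ p) ≤
      ∑' k : ℕ+, 1 / (2 * ((k : ℕ) : ℝ) ^ p) := by
  rw [tsum_pnat_eq_tsum_succ (f := fun k : ℕ => 1 / (2 * (k : ℝ) ^ p))]
  refine Summable.sum_le_tsum _ (fun k _ => by positivity) ?_
  exact summable_pnat_iff_summable_succ (f := fun k : ℕ => 1 / (2 * (k : ℝ) ^ p)) |>.1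
    (summable_one_div_two_mul_rpow hp)

/-- A collective fault of `n` locations caused by a `k`-qubit term costs at most `n / (2 m a ^ k k)`
of the weight of `n` independent faults. -/
theorem two_mul_pow_mul_le {a : ℝ} {m n k : ℕ} (ha0 : 0 < a) (ha : a < 1 / 2) (hm : 1 ≤ m)
    (hn : 1 ≤ n) (hnk : n ≤ k) : 2 * m * a ^ k * k ≤ n * (2 * m * a) ^ n := by
  -- With `k = n + d`, the `d` surplus factors `2a` are at most `1`; this is where `a < 1/2` enters.
  -- The factor `k` is absorbed by `2k ≤ 2^k`.
  obtain ⟨d, rfl⟩ := Nat.exists_eq_add_of_le hnk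
  have h1 : (2 * a) ^ d ≤ 1 := pow_le_one₀ (by positivity) (by linarith)
  have h2 : (2 : ℝ) * ((n + d : ℕ) : ℝ) ≤ 2 ^ (n + d) := by
    obtain ⟨j, hj⟩ := Nat.exists_eq_add_of_le' (hn.trans hnk)
    rw [hj, pow_succ']
    have : j + 1 ≤ 2 ^ j := Nat.lt_two_pow_self
    have : ((j + 1 : ℕ) : ℝ) ≤ 2 ^ j := by exact_mod_cast this
    linarith
  have h3 : (m : ℝ) ≤ (m : ℝ) ^ n := le_self_pow₀ (by exact_mod_cast hm) (by omega)
  have h4 : (1 : ℝ) ≤ n := by exact_mod_cast hn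
  calc 2 * m * a ^ (n + d) * ((n + d : ℕ) : ℝ)
      = m * a ^ (n + d) * (2 * ((n + d : ℕ) : ℝ)) := by ring
    _ ≤ (m : ℝ) ^ n * a ^ (n + d) * 2 ^ (n + d) := by gcongr
    _ = (2 * m * a) ^ n * (2 * a) ^ d := by rw [pow_add, pow_add, mul_pow, mul_pow, mul_pow]; ring
    _ ≤ (2 * m * a) ^ n * 1 := by gcongr
    _ ≤ n * (2 * m * a) ^ n := by
        rw [mul_one]; exact le_mul_of_one_le_left (by positivity) h4

/-- An `(n + 1)`-element set that contains `q` is enumerated by at least `n!` tuples that start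
with `q`. -/
theorem factorial_le_card_enumerations {Q : Type*} [Fintype Q] [DecidableEq Q] {n : ℕ} {q : Q}
    {S : Finset Q} (hq : q ∈ S) (hS : S.card = n + 1)
    [DecidablePred fun r : Fin n → Q => Function.Injective (Fin.cons q r : Fin (n + 1) → Q) ∧
      Finset.univ.image (Fin.cons q r : Fin (n + 1) → Q) = S] :
    n.factorial ≤ (Finset.univ.filter fun r : Fin n → Q =>
      Function.Injective (Fin.cons q r : Fin (n + 1) → Q) ∧
        Finset.univ.image (Fin.cons q r : Fin (n + 1) → Q) = S).card := by
  have hcard : Fintype.card (S.erase q) = n := by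
    rw [Fintype.card_coe, Finset.card_erase_of_mem hq, hS]; rfl
  have e₀ : Fin n ≃ S.erase q := (finCongr hcard.symm).trans (Fintype.equivFin _).symm
  have hn : Fintype.card (Fin n ≃ S.erase q) = n.factorial := by
    rw [Fintype.card_equiv e₀, Fintype.card_fin]
  rw [← hn, ← Finset.card_univ]
  -- A bijection of `Fin n` with `S.erase q` gives an enumeration of `S` after `q` is put in front.
  refine Finset.card_le_card_of_injOn (fun e j => (e j : Q)) (fun e _ => ?_) ?_
  · have hinj : Function.Injective (Fin.cons q (fun j => (e j : Q)) : Fin (n + 1) → Q) := by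
      rw [Fin.cons_injective_iff]
      refine ⟨?_, Subtype.val_injective.comp e.injective⟩
      rintro ⟨j, hj⟩
      exact (Finset.mem_erase.1 (e j).2).1 hj
    simp only [Finset.coe_filter, Finset.mem_univ, true_and, Set.mem_ofPred_eq]
    refine ⟨hinj, Finset.eq_of_subset_of_card_le ?_ ?_⟩
    · intro x hx
      rw [Finset.mem_image] at hx
      obtain ⟨j, -, rfl⟩ := hx
      induction j using Fin.cases with
      | zero => exact hq
      | succ j => exact (Finset.mem_erase.1 (e j).2).2
    · rw [Finset.card_image_of_injective _ hinj, hS, Finset.card_univ, Fintype.card_fin]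
  · intro e _ e' _ h
    ext j
    exact congrFun h j

/-! ### Collective faults dominated by independent ones -/

namespace NoiseModel

variable {Q Loc B : Type*} [Fintype Q] [DecidableEq Q] [Fintype Loc]
  [NormedAddCommGroup B] [InnerProductSpace ℂ B] [CompleteSpace B] (M : NoiseModel Q Loc B)

theorem maxDuration_nonneg : 0 ≤ M.maxDuration :=
  Real.iSup_nonneg fun l => (sub_pos.2 (M.start_lt_finish l)).le

theorem duration_le (l : Loc) : M.finish l - M.start l ≤ M.maxDuration :=
  le_ciSup (f := fun l => M.finish l - M.start l) (Set.finite_range _).bddAbove l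

theorem maxDuration_pos (l : Loc) : 0 < M.maxDuration :=
  (sub_pos.2 (M.start_lt_finish l)).trans_le (M.duration_le l)

theorem exists_norm_tupleTerm_le : ∃ c : ℝ, ∀ {k : ℕ} (i : Fin k → Q), ∀ t ∈ Set.Icc 0 M.T,
    ‖M.tupleTerm i t‖ ≤ c := by
  obtain ⟨c, hc⟩ := M.term_bounded
  refine ⟨max c 0, fun i t ht => ?_⟩
  rw [tupleTerm]
  split_ifs
  · convert (hc _ t ht).trans (le_max_left c 0)
  · simp

theorem sum_tupleTerm_mul_le_eta (k : ℕ) (q : Q) {t : ℝ} (ht : t ∈ Set.Icc 0 M.T) :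
    (∑ r : Fin (k - 1) → Q, ‖M.tupleTerm (Fin.cons q r : Fin (k - 1 + 1) → Q) t‖) *
      M.maxDuration ≤ M.eta k := by
  obtain ⟨c, hc⟩ := M.exists_norm_tupleTerm_le
  refine mul_le_mul_of_nonneg_right ?_ M.maxDuration_nonneg
  refine le_ciSup (f := fun q : Q × Set.Icc (0 : ℝ) M.T => ∑ r : Fin (k - 1) → Q,
    ‖M.tupleTerm (Fin.cons q.1 r : Fin (k - 1 + 1) → Q) q.2‖) ⟨∑ _r : Fin (k - 1) → Q, c, ?_⟩
    (q, ⟨t, ht⟩)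
  rintro _ ⟨x, rfl⟩
  exact Finset.sum_le_sum fun r _ => hc _ _ x.2.2

theorem eta_nonneg (k : ℕ) : 0 ≤ M.eta k :=
  mul_nonneg (Real.iSup_nonneg fun _ => Finset.sum_nonneg fun _ _ => norm_nonneg _)
    M.maxDuration_nonneg

/-- More indices than qubits force a coincidence, so only finitely many orders contribute to
`alpha`. -/
theorem eta_eq_zero {k : ℕ} (hk : Fintype.card Q < k) : M.eta k = 0 := by
  have h : ∀ i : Fin (k - 1 + 1) → Q, ¬ Function.Injective i := fun i hi => by
    have := Fintype.card_le_of_injective i hi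
    rw [Fintype.card_fin] at this
    omega
  simp [eta, tupleTerm, h]

theorem alpha_nonneg (p : ℝ) : 0 ≤ M.alpha p :=
  Real.iSup_nonneg fun k => Real.rpow_nonneg (mul_nonneg (by positivity) (M.eta_nonneg _)) _

/-- A real supremum dominates its members only when the family is bounded above. Here all but
finitely many members vanish, so the sum of the others is an upper bound. -/
theorem rpow_div_factorial_mul_eta_le {p a : ℝ} (ha : M.alpha p ≤ a) {k : ℕ} (hk : 0 < k) :
    (k : ℝ) ^ p / (k.factorial : ℝ) * M.eta k ≤ a ^ k := by
  have hbdd : BddAbove (Set.range fun k : ℕ+ =>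
      (((k : ℕ) : ℝ) ^ p / ((k : ℕ).factorial : ℝ) * M.eta k) ^ (1 / ((k : ℕ) : ℝ))) := by
    let f : ℕ → ℝ := fun k => ((k : ℝ) ^ p / (k.factorial : ℝ) * M.eta k) ^ (1 / (k : ℝ))
    refine ⟨∑ k ∈ Finset.range (Fintype.card Q + 1), f k, ?_⟩
    have hf : ∀ k, 0 ≤ f k := fun k =>
      Real.rpow_nonneg (mul_nonneg (by positivity) (M.eta_nonneg _)) _
    rintro _ ⟨k, rfl⟩
    by_cases hk : (k : ℕ) ∈ Finset.range (Fintype.card Q + 1)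
    · exact Finset.single_le_sum (f := f) (fun k _ => hf k) hk
    · rw [Finset.mem_range, not_lt] at hk
      have : (1 : ℝ) / ((k : ℕ) : ℝ) ≠ 0 := by positivity
      simp only [M.eta_eq_zero hk, mul_zero, Real.zero_rpow this]
      exact Finset.sum_nonneg fun k _ => hf k
  have h := (le_ciSup hbdd ⟨k, hk⟩).trans ha
  have h0 : 0 ≤ (k : ℝ) ^ p / (k.factorial : ℝ) * M.eta k :=
    mul_nonneg (by positivity) (M.eta_nonneg _)
  have h1 := pow_le_pow_left₀ (Real.rpow_nonneg h0 _) h k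
  simp only [PNat.mk_coe, one_div] at h1
  rwa [Real.rpow_inv_natCast_pow h0 hk.ne'] at h1

/-- The tuple sum counts each set through `q` at least once for every ordering of its other `n`
elements. -/
theorem factorial_mul_sum_norm_term_le (n : ℕ) (q : Q) (t : ℝ) :
    (n.factorial : ℝ) * ∑ S with q ∈ S ∧ S.card = n + 1, ‖M.term S t‖ ≤
      ∑ r : Fin n → Q, ‖M.tupleTerm (Fin.cons q r : Fin (n + 1) → Q) t‖ := by
  classical
  let P : (Fin n → Q) → Prop := fun r => Function.Injective (Fin.cons q r : Fin (n + 1) → Q)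
  let im : (Fin n → Q) → Finset Q := fun r => Finset.univ.image (Fin.cons q r : Fin (n + 1) → Q)
  calc (n.factorial : ℝ) * ∑ S with q ∈ S ∧ S.card = n + 1, ‖M.term S t‖
      = ∑ S with q ∈ S ∧ S.card = n + 1, (n.factorial : ℝ) * ‖M.term S t‖ := Finset.mul_sum _ _ _
    _ ≤ ∑ S with q ∈ S ∧ S.card = n + 1, ∑ r with P r ∧ im r = S, ‖M.term (im r) t‖ := by
        refine Finset.sum_le_sum fun S hS => ?_
        rw [Finset.mem_filter] at hS
        have h1 : ∑ r with P r ∧ im r = S, ‖M.term (im r) t‖ =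
            ((Finset.univ.filter fun r => P r ∧ im r = S).card : ℝ) * ‖M.term S t‖ := by
          rw [← nsmul_eq_mul, ← Finset.sum_const]
          refine Finset.sum_congr rfl fun r hr => ?_
          rw [(Finset.mem_filter.1 hr).2.2]
        rw [h1]
        have h2 : (n.factorial : ℝ) ≤ ((Finset.univ.filter fun r => P r ∧ im r = S).card : ℝ) :=
          Nat.cast_le.2 (factorial_le_card_enumerations hS.2.1 hS.2.2)
        exact mul_le_mul_of_nonneg_right h2 (norm_nonneg _)
    _ ≤ ∑ S, ∑ r with P r ∧ im r = S, ‖M.term (im r) t‖ :=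
        Finset.sum_le_sum_of_subset_of_nonneg (Finset.filter_subset _ _) fun S _ _ =>
          Finset.sum_nonneg fun r _ => norm_nonneg _
    _ = ∑ r with P r, ‖M.term (im r) t‖ := by
        simp only [← Finset.filter_filter]
        exact Finset.sum_fiberwise _ _ _
    _ = ∑ r : Fin n → Q, ‖M.tupleTerm (Fin.cons q r : Fin (n + 1) → Q) t‖ := by
        rw [Finset.sum_filter]
        refine Finset.sum_congr rfl fun r _ => ?_
        rw [tupleTerm]
        split_ifs
        · simp only [im]
        · simp

/-- The total weight of the terms that strike a given qubit at a given time. -/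
theorem sum_norm_term_div_le {p a : ℝ} (hp : 1 < p) (ha0 : 0 < a) (ha : M.alpha p ≤ a) {m : ℕ}
    (hm : 1 ≤ m) (q : Q) {t : ℝ} (ht : t ∈ Set.Icc 0 M.T) :
    (∑ S with q ∈ S, ‖M.term S t‖ / (2 * m * a ^ S.card * S.card)) * M.maxDuration ≤
      (∑' k : ℕ+, 1 / (2 * ((k : ℕ) : ℝ) ^ p)) / m := by
  have hm0 : (0 : ℝ) < m := by exact_mod_cast hm
  -- The terms are sorted by `n = S.card - 1`, and each size is compared with one summand of the
  -- series.
  have hmaps : ∀ S ∈ Finset.univ.filter fun S : Finset Q => q ∈ S,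
      S.card - 1 ∈ Finset.range (Fintype.card Q) := by
    intro S hS
    have h1 := Finset.card_pos.2 ⟨q, (Finset.mem_filter.1 hS).2⟩
    have h2 := Finset.card_le_univ S
    rw [Finset.mem_range]
    omega
  rw [← Finset.sum_fiberwise_of_maps_to hmaps, Finset.sum_mul]
  refine le_trans ?_ (div_le_div_of_nonneg_right
    (sum_le_tsum_one_div_two_mul_rpow hp (Fintype.card Q)) hm0.le)
  rw [Finset.sum_div]
  refine Finset.sum_le_sum fun n _ => ?_
  have hset : ((Finset.univ.filter fun S : Finset Q => q ∈ S).filter fun S => S.card - 1 = n) =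
      Finset.univ.filter fun S : Finset Q => q ∈ S ∧ S.card = n + 1 := by
    ext S
    simp only [Finset.mem_filter, Finset.mem_univ, true_and]
    refine and_congr_right fun hS => ?_
    have h1 := Finset.card_pos.2 ⟨q, hS⟩
    omega
  have hsum : ∑ S with q ∈ S ∧ S.card = n + 1, ‖M.term S t‖ / (2 * m * a ^ S.card * S.card) =
      (∑ S with q ∈ S ∧ S.card = n + 1, ‖M.term S t‖) / (2 * m * a ^ (n + 1) * (n + 1 : ℕ)) := by
    rw [Finset.sum_div]
    refine Finset.sum_congr rfl fun S hS => ?_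
    rw [(Finset.mem_filter.1 hS).2.2]
  rw [hset, hsum]
  set σ := ∑ S with q ∈ S ∧ S.card = n + 1, ‖M.term S t‖
  have h1 := M.factorial_mul_sum_norm_term_le n q t
  have h2 := M.sum_tupleTerm_mul_le_eta (n + 1) q ht
  have h3 := M.rpow_div_factorial_mul_eta_le ha n.succ_pos
  have h4 : (n.factorial : ℝ) * σ * M.maxDuration ≤ M.eta (n + 1) :=
    (mul_le_mul_of_nonneg_right h1 M.maxDuration_nonneg).trans h2
  have hx : (0 : ℝ) < ((n + 1 : ℕ) : ℝ) ^ p := by positivity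
  have hf : (0 : ℝ) < n.factorial := by positivity
  -- With `k = n + 1`, the bounds `(k-1)! σ t₀ ≤ η_k` and `k^p η_k / k! ≤ a^k` combine to this; the
  -- factor `k` left from `k! = k (k-1)!` is the one in the denominator of the weights.
  have h5 : ((n + 1 : ℕ) : ℝ) ^ p * (σ * M.maxDuration) ≤ a ^ (n + 1) * (n + 1 : ℕ) := by
    refine le_trans ?_ (mul_le_mul_of_nonneg_right h3 (Nat.cast_nonneg (n + 1)))
    rw [Nat.succ_eq_add_one, Nat.factorial_succ]
    push_cast
    rw [div_mul_eq_mul_div, div_mul_eq_mul_div, le_div_iff₀ (by positivity)]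
    push_cast at hx
    nlinarith [mul_le_mul_of_nonneg_left h4 (mul_pos hx (by positivity : (0 : ℝ) < n + 1)).le]
  rw [div_mul_eq_mul_div, div_div, div_le_div_iff₀ (by positivity) (by positivity)]
  nlinarith [mul_le_mul_of_nonneg_left h5 (mul_pos two_pos hm0).le]

/-- A struck location is represented by a qubit that it shares with `S`. Locations running at the
same time have disjoint qubits, so distinct ones get distinct representatives. -/
theorem card_struck_inter_le [DecidableEq Loc] (S : Finset Q) (t : ℝ) (R : Finset Loc) :
    (M.struck S t ∩ R).card ≤ S.card := by
  have h : ∀ l : Loc, ∃ q : Q, l ∈ M.struck S t → q ∈ S ∩ M.qubits l := fun l => by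
    obtain ⟨q, -⟩ := M.qubits_nonempty l
    by_cases hl : l ∈ M.struck S t
    · obtain ⟨q, hq⟩ := (M.mem_struck.1 hl).2
      exact ⟨q, fun _ => hq⟩
    · exact ⟨q, fun h => absurd h hl⟩
  choose f hf using h
  refine Finset.card_le_card_of_injOn f (fun l hl => ?_) fun l hl l' hl' hll => ?_
  · exact (Finset.mem_inter.1 (hf l (Finset.mem_inter.1 hl).1)).1
  · have h1 := (Finset.mem_inter.1 hl).1
    have h2 := (Finset.mem_inter.1 hl').1
    by_contra hne
    have h3 := M.disjoint l l' hne fun hd => by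
      have h4 := (Finset.mem_inter.1 (hf l h1)).2
      have h5 := (Finset.mem_inter.1 (hf l' h2)).2
      rw [← hll] at h5
      exact Finset.disjoint_left.1 hd h4 h5
    exact Set.disjoint_left.1 h3 (M.mem_struck.1 h1).1 (M.mem_struck.1 h2).1

/-- The weighted domination of the collective faults by independent ones. -/
theorem sum_norm_interactionTerm_mul_pow_le [DecidableEq Loc] {p a : ℝ} (hp : 1 < p) (ha0 : 0 < a)
    (ha2 : a < 1 / 2) (ha : M.alpha p ≤ a) {m : ℕ} (hm : 1 ≤ m)
    (hcard : ∀ l, (M.qubits l).card ≤ m) (R : Finset Loc) (τ : ℝ) :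
    (∑ S with (M.struck S τ ∩ R).Nonempty,
      ‖M.interactionTerm S τ‖ * (2 * m * a) ^ (R \ M.struck S τ).card) ≤
    (2 * m * a) ^ R.card * ∑ l ∈ R, (M.window l).indicator
      (fun _ => (∑' k : ℕ+, 1 / (2 * ((k : ℕ) : ℝ) ^ p)) / M.maxDuration) τ := by
  set D := ∑' k : ℕ+, 1 / (2 * ((k : ℕ) : ℝ) ^ p) with hD
  have hD0 : 0 ≤ D := tsum_nonneg fun k => by positivity
  have hm0 : (0 : ℝ) < m := by exact_mod_cast hm
  have hw : 0 < 2 * m * a := by positivity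
  by_cases hτ : τ ∈ Set.Icc 0 M.T
  swap
  · simp only [M.interactionTerm_of_notMem _ hτ, norm_zero, zero_mul, Finset.sum_const_zero]
    refine mul_nonneg (by positivity) (Finset.sum_nonneg fun l _ => ?_)
    exact Set.indicator_nonneg (fun _ _ => div_nonneg hD0 M.maxDuration_nonneg) _
  -- The share of a term charged to each location that it strikes. At `S = ∅` the division by zero
  -- gives `0`.
  let G : Finset Q → ℝ := fun S => ‖M.term S τ‖ / (2 * m * a ^ S.card * S.card)
  have hG : ∀ S, 0 ≤ G S := fun S => by positivity
  have h1 : ∀ S ∈ Finset.univ.filter fun S => (M.struck S τ ∩ R).Nonempty,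
      ‖M.interactionTerm S τ‖ * (2 * m * a) ^ (R \ M.struck S τ).card ≤
        (2 * m * a) ^ R.card * ∑ l ∈ R, if l ∈ M.struck S τ then G S else 0 := by
    intro S hS
    have hn : 1 ≤ (M.struck S τ ∩ R).card := Finset.card_pos.2 (Finset.mem_filter.1 hS).2
    have hk := M.card_struck_inter_le S τ R
    have hineq := two_mul_pow_mul_le ha0 ha2 hm hn hk
    rw [← Finset.sum_filter, Finset.filter_mem_eq_inter, Finset.sum_const, Finset.inter_comm,
      nsmul_eq_mul, ← Finset.card_sdiff_add_card_inter R (M.struck S τ), pow_add,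
      Finset.inter_comm R]
    set n := (M.struck S τ ∩ R).card
    have hden : 0 < 2 * m * a ^ S.card * S.card := by
      have : (0 : ℝ) < S.card := by exact_mod_cast hn.trans hk
      positivity
    have h2 : ‖M.term S τ‖ ≤ (2 * m * a) ^ n * (n * G S) := by
      simp only [G]
      rw [← mul_div_assoc, ← mul_div_assoc, le_div_iff₀ hden]
      nlinarith [mul_le_mul_of_nonneg_left hineq (norm_nonneg (M.term S τ))]
    calc _ ≤ ((2 * m * a) ^ n * (n * G S)) * (2 * m * a) ^ (R \ M.struck S τ).card := by
          gcongr
          exact (M.norm_interactionTerm_le S τ).trans h2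
      _ = _ := by ring
  refine (Finset.sum_le_sum h1).trans ?_
  rw [← Finset.mul_sum]
  refine mul_le_mul_of_nonneg_left ?_ (by positivity)
  refine (Finset.sum_le_sum_of_subset_of_nonneg (Finset.filter_subset _ _) fun S _ _ =>
    Finset.sum_nonneg fun l _ => by split_ifs <;> [exact hG S; exact le_rfl]).trans ?_
  rw [Finset.sum_comm]
  refine Finset.sum_le_sum fun l _ => ?_
  have ht0 := M.maxDuration_pos l
  by_cases hl : τ ∈ M.window l
  swap
  · simp [mem_struck, hl]
  rw [Set.indicator_of_mem hl]
  -- A term that strikes `l` meets one of its qubits, so a union bound over these at most `m` qubits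
  -- applies.
  calc ∑ S, (if l ∈ M.struck S τ then G S else 0)
      ≤ ∑ S, ∑ q ∈ M.qubits l, if q ∈ S then G S else 0 := by
        refine Finset.sum_le_sum fun S _ => ?_
        split_ifs with hS
        · obtain ⟨q, hq⟩ := (M.mem_struck.1 hS).2
          rw [Finset.mem_inter] at hq
          refine le_trans ?_ (Finset.single_le_sum (f := fun q => if q ∈ S then G S else 0)
            (fun q _ => by split_ifs <;> [exact hG S; exact le_rfl]) hq.2)
          rw [if_pos hq.1]
        · exact Finset.sum_nonneg fun q _ => by split_ifs <;> [exact hG S; exact le_rfl]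
    _ = ∑ q ∈ M.qubits l, ∑ S with q ∈ S, G S := by
        rw [Finset.sum_comm]
        simp only [Finset.sum_filter]
    _ ≤ ∑ q ∈ M.qubits l, D / m / M.maxDuration :=
        Finset.sum_le_sum fun q _ => (le_div_iff₀ ht0).2 (M.sum_norm_term_div_le hp ha0 ha hm q hτ)
    _ ≤ m * (D / m / M.maxDuration) := by
        rw [Finset.sum_const, nsmul_eq_mul]
        have : ((M.qubits l).card : ℝ) ≤ m := by exact_mod_cast hcard l
        gcongr
    _ = D / M.maxDuration := by field_simp

/-- The terms are bounded only on `[0, T]`; the cut-off turns this into the bound at all times that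
the Dyson estimates require. -/
theorem exists_norm_interactionTerm_le : ∃ c : ℝ, ∀ S t, ‖M.interactionTerm S t‖ ≤ c := by
  obtain ⟨c, hc⟩ := M.term_bounded
  refine ⟨max c 0, fun S t => ?_⟩
  by_cases ht : t ∈ Set.Icc 0 M.T
  · exact ((M.norm_interactionTerm_le S t).trans (hc S t ht)).trans (le_max_left _ _)
  · simp [M.interactionTerm_of_notMem S ht]

theorem integral_window_le {D : ℝ} (hD : 0 ≤ D) (l : Loc) :
    ∫ τ in (0 : ℝ)..M.T, (M.window l).indicator (fun _ => D / M.maxDuration) τ ≤ D := by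
  have ht0 := M.maxDuration_pos l
  have hw : MeasurableSet (M.window l) := measurableSet_Ico
  have hc : 0 ≤ D / M.maxDuration := by positivity
  rw [intervalIntegral.integral_of_le M.T_nonneg]
  calc _ ≤ ∫ τ, (M.window l).indicator (fun _ => D / M.maxDuration) τ := by
        refine setIntegral_le_integral ?_ (ae_of_all _ fun τ => Set.indicator_nonneg (fun _ _ => hc) _)
        rw [integrable_indicator_iff hw]
        exact integrableOn_const (by simp [Circuit.window])
    _ = (M.finish l - M.start l) * (D / M.maxDuration) := by
        rw [integral_indicator hw, setIntegral_const, smul_eq_mul]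
        simp [Circuit.window, Measure.real, (M.start_lt_finish l).le]
    _ ≤ M.maxDuration * (D / M.maxDuration) := by
        gcongr
        exact M.duration_le l
    _ = D := by field_simp

/-- A parameter `a ≥ α_p` replaces `α_p` itself because the weight `w = 2ma` must be strictly
positive, while `α_p` may be `0`. -/
theorem norm_dysonSum_interaction_le [DecidableEq Loc] {p a : ℝ} (hp : 1 < p) (ha0 : 0 < a)
    (ha2 : a < 1 / 2) (ha : M.alpha p ≤ a) {m : ℕ} (hcard : ∀ l, (M.qubits l).card ≤ m)
    (I : Finset Loc) (ψ : JointSpace Q B) :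
    ‖dysonSum M.interactionTerm M.struck I M.T ψ‖ ≤ noiseBound m p a ^ I.card * ‖ψ‖ := by
  obtain ⟨c, hc⟩ := M.exists_norm_interactionTerm_le
  set D := ∑' k : ℕ+, 1 / (2 * ((k : ℕ) : ℝ) ^ p) with hD
  have hD0 : 0 ≤ D := tsum_nonneg fun k => by positivity
  have hDt : 0 ≤ D / M.maxDuration := div_nonneg hD0 M.maxDuration_nonneg
  -- without locations the value of `m` does not matter
  obtain ⟨m', hm', hcard', hI⟩ : ∃ m' : ℕ, 1 ≤ m' ∧ (∀ l, (M.qubits l).card ≤ m') ∧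
      (2 * m' * a) ^ I.card = (2 * m * a) ^ I.card := by
    by_cases hL : Nonempty Loc
    · exact ⟨m, (Finset.card_pos.2 (M.qubits_nonempty hL.some)).trans_le (hcard _), hcard, rfl⟩
    · rw [not_nonempty_iff] at hL
      refine ⟨1, le_rfl, fun l => hL.elim l, ?_⟩
      rw [Finset.eq_empty_of_isEmpty I, Finset.card_empty, pow_zero, pow_zero]
  have hm0 : (0 : ℝ) < m' := by exact_mod_cast hm'
  have h := norm_dysonSum_le (h := M.interactionTerm) (hit := M.struck)
    M.stronglyMeasurable_interactionTerm hc
    M.isSelfAdjoint_interactionTerm M.measurableSet_struck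
    (k := fun l => (M.window l).indicator fun _ => D / M.maxDuration)
    (κ := D / M.maxDuration) (w := 2 * m' * a) (by positivity)
    (fun l t => Set.indicator_nonneg (fun _ _ => hDt) _)
    (fun l t => Set.indicator_le_self' (fun _ _ => hDt) t)
    (fun l => measurable_const.indicator measurableSet_Ico)
    (fun R τ => M.sum_norm_interactionTerm_mul_pow_le hp ha0 ha2 ha hm' hcard' R τ)
    ψ I M.T M.T_nonneg
  refine h.trans (mul_le_mul_of_nonneg_right ?_ (norm_nonneg _))
  have hint : ∫ τ in (0 : ℝ)..M.T, ∑ l ∈ I, (M.window l).indicator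
      (fun _ => D / M.maxDuration) τ ≤ I.card * D := by
    have hii : ∀ l ∈ I, IntervalIntegrable ((M.window l).indicator fun _ => D / M.maxDuration)
        volume 0 M.T := fun l _ => intervalIntegrable_of_norm_le
      (measurable_const.indicator measurableSet_Ico).stronglyMeasurable M.T_nonneg fun τ _ =>
        norm_indicator_le_norm_self (fun _ => D / M.maxDuration) τ
    rw [intervalIntegral.integral_finsetSum hii, ← nsmul_eq_mul, ← Finset.sum_const]
    exact Finset.sum_le_sum fun l _ => M.integral_window_le hD0 l
  -- The argument gives the exponent `D` per location; the factor `C(a)` only weakens it.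
  have hC : 1 ≤ enhancement a := by
    rw [enhancement]
    exact (one_le_inv₀ (by linarith)).2 (by linarith)
  have hCD : D ≤ enhancement a * D := le_mul_of_one_le_left hD0 hC
  rw [hI, noiseBound, mul_pow (2 * m * a), ← Real.exp_nat_mul]
  gcongr
  exact hint.trans (mul_le_mul_of_nonneg_left hCD (Nat.cast_nonneg _))

theorem hasEffectiveNoiseStrength_noiseBound {p : ℝ} (hp : 1 < p) {m : ℕ}
    (hcard : ∀ l, (M.qubits l).card ≤ m) (hα : M.alpha p < 1 / 2) :
    M.HasEffectiveNoiseStrength (noiseBound m p (M.alpha p)) := by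
  classical
  have h0 := M.alpha_nonneg p
  have hε : 0 ≤ noiseBound m p (M.alpha p) := by
    rw [noiseBound]; positivity
  refine ⟨hε, fun I => ?_⟩
  obtain ⟨c, hc⟩ := M.exists_norm_interactionTerm_le
  obtain ⟨E, hE, hnorm⟩ := M.exists_isFaultOperator hc I
  refine ⟨E, hE, ContinuousLinearMap.opNorm_le_bound _ (by positivity) fun ψ => ?_⟩
  rw [hnorm]
  have hcont : ContinuousAt (fun a => noiseBound m p a ^ I.card * ‖ψ‖) (M.alpha p) := by
    have : 1 - 2 * M.alpha p ≠ 0 := by linarith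
    unfold noiseBound enhancement
    fun_prop (disch := exact this)
  -- The estimate holds for every `a` in `(α_p, 1/2)` and passes to the limit `a → α_p` from the
  -- right, since `noiseBound` is continuous where `1 - 2α ≠ 0`.
  refine ge_of_tendsto (hcont.tendsto.mono_left (nhdsWithin_le_nhds (s := Set.Ioi (M.alpha p)))) ?_
  filter_upwards [Ioo_mem_nhdsGT hα] with a ha
  convert M.norm_dysonSum_interaction_le hp (h0.trans_lt ha.1) ha.2 ha.1.le hcard I ψ

end NoiseModel

end

/-! ### The case `p = 2` and the final theorem -/

theorem tsum_one_div_two_mul_rpow_two :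
    ∑' k : ℕ+, 1 / (2 * ((k : ℕ) : ℝ) ^ (2 : ℝ)) = Real.pi ^ 2 / 12 := by
  rw [tsum_pnat_eq_tsum_succ (f := fun k : ℕ => 1 / (2 * (k : ℝ) ^ (2 : ℝ)))]
  -- The zeta series is indexed from `0`, where its term `1 / 0 ^ 2` is `0` by convention, so
  -- dropping that term does not change the sum.
  have h := ((hasSum_nat_add_iff' 1).2 hasSum_zeta_two).mul_left (1 / 2 : ℝ)
  rw [Finset.sum_range_one] at h
  have h2 : 1 / 2 * (Real.pi ^ 2 / 6 - 1 / ((0 : ℕ) : ℝ) ^ 2) = Real.pi ^ 2 / 12 := by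
    norm_num
    ring
  rw [h2] at h
  rw [← h.tsum_eq]
  refine tsum_congr fun k => ?_
  rw [one_div_mul_one_div, Real.rpow_two]

theorem noiseBound_two (m : ℕ) (α : ℝ) :
    noiseBound m 2 α = 2 * m * α * Real.exp (Real.pi ^ 2 / 12) ^ enhancement α := by
  rw [noiseBound, tsum_one_div_two_mul_rpow_two, ← Real.exp_mul, mul_comm (enhancement α)]

theorem continuousAt_noiseBound_zero (m : ℕ) (p : ℝ) : ContinuousAt (noiseBound m p) 0 := by
  have : (1 : ℝ) - 2 * 0 ≠ 0 := by norm_num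
  unfold noiseBound enhancement
  fun_prop (disch := exact this)

theorem tendsto_noiseBound_two_div (m : ℕ) :
    Tendsto (fun α : ℝ => noiseBound m 2 α / α) (𝓝[>] 0)
      (𝓝 (m * (2 * Real.exp (Real.pi ^ 2 / 12)))) := by
  have hc : ContinuousAt (fun α : ℝ => 2 * m * Real.exp (enhancement α * (Real.pi ^ 2 / 12))) 0 := by
    have : (1 : ℝ) - 2 * 0 ≠ 0 := by norm_num
    unfold enhancement
    fun_prop (disch := exact this)
  have h := hc.tendsto.mono_left (nhdsWithin_le_nhds (s := Set.Ioi 0))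
  have h0 : 2 * m * Real.exp (enhancement 0 * (Real.pi ^ 2 / 12)) =
      m * (2 * Real.exp (Real.pi ^ 2 / 12)) := by
    rw [enhancement, mul_zero, sub_zero, inv_one, one_mul]
    ring
  rw [h0] at h
  refine h.congr' ?_
  filter_upwards [self_mem_nhdsWithin] with α hα
  have : α ≠ 0 := ne_of_gt hα
  rw [noiseBound, tsum_one_div_two_mul_rpow_two]
  field_simp

/-- Four decimals of `π` place `π²/12` between `0.822` and `0.8225`; eight Taylor terms of the
exponential at these points, with a remainder bound at the upper one, suffice. -/
theorem abs_two_mul_exp_sub_lt : |2 * Real.exp (Real.pi ^ 2 / 12) - 4.55| < 0.005 := by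
  have h1 := Real.pi_gt_d4
  have h2 := Real.pi_lt_d4
  have hl : (0.822 : ℝ) ≤ Real.pi ^ 2 / 12 := by nlinarith
  have hu : Real.pi ^ 2 / 12 ≤ (0.8225 : ℝ) := by nlinarith
  have el := Real.exp_le_exp.2 hl
  have eu := Real.exp_le_exp.2 hu
  have b1 : (2.274 : ℝ) < Real.exp 0.822 := by
    have := Real.sum_le_exp_of_nonneg (x := 0.822) (by norm_num) 8
    refine lt_of_lt_of_le ?_ this
    norm_num [Finset.sum_range_succ, Nat.factorial]
  have b2 : Real.exp 0.8225 < (2.277 : ℝ) := by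
    refine (Real.exp_bound' (x := 0.8225) (by norm_num) (by norm_num) (n := 8)
      (by norm_num)).trans_lt ?_
    norm_num [Finset.sum_range_succ, Nat.factorial]
  rw [abs_lt]
  constructor <;> linarith

theorem corollary2 (p : ℝ) (hp : 1 < p) (m : ℕ) :
    -- the sum in the bound is finite
    (Summable fun k : ℕ+ => 1 / (2 * ((k : ℕ) : ℝ) ^ p)) ∧
    -- the bound on the effective noise strength
    (∀ (Q : Type*) (Loc : Type*) (B : Type*) [Fintype Q] [DecidableEq Q] [Fintype Loc]
        [NormedAddCommGroup B] [InnerProductSpace ℂ B] [CompleteSpace B]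
        (M : NoiseModel Q Loc B),
        (∀ l, (M.qubits l).card ≤ m) → M.alpha p < 1 / 2 →
          M.HasEffectiveNoiseStrength (noiseBound m p (M.alpha p))) ∧
    -- any threshold is met for all sufficiently small nonzero values, uniformly in the model
    (∀ ε₀ : ℝ, 0 < ε₀ → ∃ α₀ : ℝ, 0 < α₀ ∧
      ∀ (Q : Type*) (Loc : Type*) (B : Type*) [Fintype Q] [DecidableEq Q] [Fintype Loc]
        [NormedAddCommGroup B] [InnerProductSpace ℂ B] [CompleteSpace B]
        (M : NoiseModel Q Loc B),
        (∀ l, (M.qubits l).card ≤ m) → M.alpha p < α₀ →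
          ∃ ε < ε₀, M.HasEffectiveNoiseStrength ε) ∧
    -- the case `p = 2`: the bound is `2 m α (e^{π²/12})^{C(α)}`, about `4.55 m α` for small `α`
    (∀ α : ℝ, noiseBound m 2 α =
        2 * m * α * Real.exp (Real.pi ^ 2 / 12) ^ enhancement α) ∧
    Tendsto (fun α : ℝ => noiseBound m 2 α / α) (𝓝[>] 0)
        (𝓝 (m * (2 * Real.exp (Real.pi ^ 2 / 12)))) ∧
    |2 * Real.exp (Real.pi ^ 2 / 12) - 4.55| < 0.005 := by
  refine ⟨summable_one_div_two_mul_rpow hp, ?_, ?_, noiseBound_two m,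
    tendsto_noiseBound_two_div m, abs_two_mul_exp_sub_lt⟩
  · intro Q Loc B _ _ _ _ _ _ M hcard hα
    exact M.hasEffectiveNoiseStrength_noiseBound hp hcard hα
  · intro ε₀ hε₀
    have h0 : noiseBound m p 0 = 0 := by simp [noiseBound]
    have hev := (continuousAt_noiseBound_zero m p).eventually_lt_const (h0.trans_lt hε₀)
    obtain ⟨δ, hδ, hball⟩ := Metric.eventually_nhds_iff.1 hev
    -- `δ` makes the bound smaller than `ε₀`, and `1 / 2` keeps part 1 applicable. Neither depends
    -- on the model.
    refine ⟨min δ (1 / 2), by positivity, fun Q Loc B _ _ _ _ _ _ M hcard hα => ?_⟩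
    refine ⟨_, hball ?_, M.hasEffectiveNoiseStrength_noiseBound hp hcard
      (hα.trans_le (min_le_right _ _))⟩
    rw [dist_zero_right, Real.norm_of_nonneg (M.alpha_nonneg p)]
    exact hα.trans_le (min_le_left _ _)
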